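/- Depth-first search (DFS). Let $D$ be a finite multidigraph (loops and multiple arcs allowed) on the vertices $1,\dots,n$ in which the arcs out of every vertex are listed in a given order. DFS starts at the unseen vertex with the smallest label and explores the arcs from it one by one; whenever an arc leads to a vertex not seen before, that vertex is explored in the same way, recursively, before DFS returns to the next arc from its parent. When a tree is completed, DFS starts a new tree at the unseen vertex with the smallest label, until all vertices have been seen. An explored arc from $u$ to $v$ is a loop if $v=u$, a tree arc if $v$ was unseen, a back arc if $v$ is a proper ancestor of $u$ in the current tree, a forward arc if $v$ is an already seen proper descendant of $u$, and a cross arc otherwise. Let $L,F,B,C,T$ be the numbers of loops, forward, back, cross and tree arcs. Let $F_n(w,x,y,z,t)$ be the formal power series $\sum w^Lx^Fy^Bz^Ct^T$, where the sum runs over all instances of DFS on $n$ vertices (i.e. over all multidigraphs with ordered lists of outgoing arcs as above). For $p\in(0,1)$, consider also DFS in the random digraph on $n$ vertices in which the outdegrees $\eta_i$ of the vertices are independent with $\mathbb P(\eta_i=k)=p^k(1-p)$, $k\ge0$, and the endpoints of all arcs are independent and uniformly distributed on the $n$ vertices. Let $\hat G^X_n(w,x,z)$ and $\hat G^Y_n(w,x,z)$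 be the formal power series defined by $$\hat G^X_1(w,x,z):=\hat G^Y_1(w,x,z):=\frac1{1-w}$$ and, for $n\ge2$, $$\hat G^X_n(w,x,z):=\frac1{1-w-(n-1)x}\sum_{m=1}^{n-1}\hat G^X_m(w,x,z)\,\hat G^X_{n-m}(w+mz,x,z),$$ $$\hat G^Y_n(w,x,z):=\frac1{1-w-(n-1)z}\sum_{m=1}^{n-1}\hat G^Y_m(w,x,z)\,\hat G^Y_{n-m}(w+x+(m-1)z,x,z).$$ **Proposition.** The following are equivalent: 1. for every $n\ge1$ and every $p\in(0,1)$, $(L,F,B+C,T)$ and $(L,B,F+C,T)$ have the same distribution for DFS in the random digraph above; 2. $F_n(w,x,z,z,t)=F_n(w,z,x,z,t)$ for every $n\ge1$; 3. $\hat G^X_n(w,x,z)=\hat G^Y_n(w,x,z)$ for every $n\ge1$. -/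

import Mathlib

open MeasureTheory ProbabilityTheory MvPowerSeries

namespace DepthFirst

/-- The five types of arcs in a depth-first search. -/
inductive ArcType
  | loop | forward | back | cross | tree
  deriving DecidableEq

/-- A finite multidigraph on the vertices `0, …, n - 1`, presented as a depth-first search meets it:
to every vertex belongs the finite list of the endpoints of its outgoing arcs, in the order in which
the arcs are explored. Loops and multiple arcs are allowed. -/
abbrev Arcs (n : ℕ) : Type := Fin n → List (Fin n)

/-- The state of a depth-first search: `anc v` is `none` if `v` has not been seen yet, and otherwise
is the list of the proper ancestors of `v` in its tree of the depth-first forest, from the parent of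
`v` up to the root; `count k` is the number of arcs of type `k` explored so far. -/
structure State (n : ℕ) where
  anc : Fin n → Option (List (Fin n))
  count : ArcType → ℕ

variable {n : ℕ}

/-- The type of an arc from the current vertex `u` to `v` that is explored in state `s`. -/
def State.arcType (s : State n) (u v : Fin n) : ArcType :=
  match s.anc v with
  | none => .tree
  | some a =>
    if v = u then .loop
    else if v ∈ (s.anc u).getD [] then .back
    else if u ∈ a then .forward
    else .cross

/-- Count the arc from `u` to `v`. -/
def State.record (s : State n) (u v : Fin n) : State n :=
  { s with count := fun k => if k = s.arcType u v then s.count k + 1 else s.count k }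

/-- Mark `v` as seen, with the list `a` of proper ancestors. -/
def State.discover (s : State n) (v : Fin n) (a : List (Fin n)) : State n :=
  { s with anc := Function.update s.anc v (some a) }

/-- Explore one by one the arcs from the newly seen vertex `u`; whenever an arc leads to an unseen
vertex, explore that vertex recursively before returning to the next arc from `u`. The first explicit
argument bounds the depth of the recursion. As the vertices along a branch are distinct, the bound
`n` used below is never exceeded, so that the clause for `0` is never reached. -/
def visit (g : Arcs n) : ℕ → Fin n → State n → State n
  | 0, _, s => s
  | d + 1, u, s =>
    (g u).foldl (fun s v =>
      match s.anc v with
      | some _ => s.record u v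
      | none => visit g d v ((s.record u v).discover v (u :: (s.anc u).getD []))) s

/-- The final state of the depth-first search of `g`: as long as there are unseen vertices, a new
tree is started at the unseen vertex with the smallest label. -/
def search (g : Arcs n) : State n :=
  (List.finRange n).foldl (fun s r =>
    match s.anc r with
    | some _ => s
    | none => visit g n r (s.discover r [])) ⟨fun _ => none, fun _ => 0⟩

/-- The number of loops in the depth-first search of `g`. -/
def numL (g : Arcs n) : ℕ := (search g).count .loop
/-- The number of forward arcs in the depth-first search of `g`. -/
def numF (g : Arcs n) : ℕ := (search g).count .forward
/-- The number of back arcs in the depth-first search of `g`. -/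
def numB (g : Arcs n) : ℕ := (search g).count .back
/-- The number of cross arcs in the depth-first search of `g`. -/
def numC (g : Arcs n) : ℕ := (search g).count .cross
/-- The number of tree arcs in the depth-first search of `g`. -/
def numT (g : Arcs n) : ℕ := (search g).count .tree

/-- All sets of lists of vertices are measurable. -/
instance : MeasurableSpace (List (Fin n)) := ⊤

open unitInterval in
/-- The law of the outgoing arcs of one vertex: the outdegree is `k` with probability
`p ^ k * (1 - p)`, and, given the outdegree, the endpoints are independent and uniformly distributed
on all `n` vertices. -/
noncomputable def outLaw (n : ℕ) (p : unitInterval) : Measure (List (Fin n)) :=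
  (geometricMeasure (σ p)).bind fun k =>
    (Measure.pi fun _ : Fin k => uniformOn (Set.univ : Set (Fin n))).map List.ofFn

/-- The law of the random digraph with geometric outdegrees; the vertices are independent. -/
noncomputable def digraphLaw (n : ℕ) (p : unitInterval) : Measure (Arcs n) :=
  Measure.pi fun _ : Fin n => outLaw n p

/-- The generating function `F_n(w, x, y, z, t)`: the sum of `w ^ L * x ^ F * y ^ B * z ^ C * t ^ T`
over all instances of a depth-first search on `n` vertices, as a formal power series in the variables
`w, x, y, z, t = X 0, X 1, X 2, X 3, X 4`. Its coefficients are given: each counts the instances with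
prescribed values of `L, F, B, C, T`, and there are finitely many of them, since every arc of the
digraph is explored exactly once. -/
noncomputable def genF (n : ℕ) : MvPowerSeries (Fin 5) ℚ := fun m =>
  ({g : Arcs n | numL g = m 0 ∧ numF g = m 1 ∧ numB g = m 2 ∧ numC g = m 3 ∧ numT g = m 4}.ncard : ℚ)

/-- The power series `Ĝ^X_n(w, x, z)` in the variables `w, x, z = X 0, X 1, X 2`, for `n ≥ 1`. -/
noncomputable def GX (n : ℕ) : MvPowerSeries (Fin 3) ℚ :=
  if n = 1 then (1 - X 0)⁻¹
  else (1 - X 0 - ((n : MvPowerSeries (Fin 3) ℚ) - 1) * X 1)⁻¹ *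
    ∑ m : Finset.Ico 1 n, GX m * (GX (n - m)).subst
      ![X 0 + (m : MvPowerSeries (Fin 3) ℚ) * X 2, X 1, X 2]
termination_by n
decreasing_by all_goals (have := Finset.mem_Ico.1 m.2; omega)

/-- The power series `Ĝ^Y_n(w, x, z)` in the variables `w, x, z = X 0, X 1, X 2`, for `n ≥ 1`. -/
noncomputable def GY (n : ℕ) : MvPowerSeries (Fin 3) ℚ :=
  if n = 1 then (1 - X 0)⁻¹
  else (1 - X 0 - ((n : MvPowerSeries (Fin 3) ℚ) - 1) * X 2)⁻¹ *
    ∑ m : Finset.Ico 1 n, GY m * (GY (n - m)).subst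
      ![X 0 + X 1 + ((m : MvPowerSeries (Fin 3) ℚ) - 1) * X 2, X 1, X 2]
termination_by n
decreasing_by all_goals (have := Finset.mem_Ico.1 m.2; omega)

end DepthFirst

open DepthFirst

/-!
The search is a sequence of steps. Suppose that it is interrupted when the vertices of a stack are
being explored: the current vertex and its ancestors. Every vertex that is on the stack or has not
been seen then has a list of arcs still to be explored, and these lists are arbitrary. If the list
of the current vertex is empty, the vertex is removed from the stack; otherwise its first arc is
explored, and a new vertex is put on the stack if the arc leads to one. The possible lists before
and after the step are in bijection (`arcsGF_eq_erase_add`), and the number of the possible arcs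
of each type depends only on the numbers of vertices that had been seen before each vertex of the
stack (`State.Interrupted.sum_arcType`). Hence the generating function of the ways to finish the
search satisfies a linear recursion.

The recursion is solved by `stackGF`, which is built from the generating functions `treeGF` of the
ways to explore a tree. The recursion splits a tree at the next step of its root, `treeGF` at the
last child of its root; the two decompositions agree because a left inverse of a triangular matrix
is also a right inverse (`first_step_of_last_step`). This gives `arcsGF_search`: the generating
function of all searches on `n` vertices, in any variables for the five types of arcs, is `n ! *
forestGF`, a sum over the sizes of the trees of the depth-first forest.

With the variables `w, x, z, z` or `w, z, x, z` for loops and forward, back and cross arcs,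
`treeGF` becomes `GX n` or `GY n`. So `GX = GY` implies the identity for the generating functions
of searches. Conversely, the forests with a single tree contribute `(n - 1)! * t ^ (n - 1) *
treeGF` to the generating function of the searches, and the other forests involve smaller trees
only, so that induction on `n` gives `GX n = GY n` (`forall_forestGF_eq_iff`).

Finally, every arc is explored exactly once (`total_finish`), so that each of the vectors `(L, F,
B + C, T)` and `(L, B, F + C, T)` determines the number of arcs, and with it the probability of
the digraph under the random model (`digraphLaw_singleton`). Equality in distribution, already for
a single `p`, thus means that the numbers of digraphs with given values of the two vectors agree,
which is an equality of coefficients of the two generating functions (`forestGF_eq_iff_ncard_eq`).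
-/

/-! ### Elementary properties of the search -/

namespace DepthFirst

variable {n : ℕ} {σ τ : Type*}

/-- `s.Le s'`: every vertex seen in `s` is seen in `s'`, with the same ancestors. -/
def State.Le (s s' : State n) : Prop := ∀ v a, s.anc v = some a → s'.anc v = some a

theorem State.Le.refl (s : State n) : s.Le s := fun _ _ h => h

theorem State.Le.trans {s s' s'' : State n} (h : s.Le s') (h' : s'.Le s'') : s.Le s'' :=
  fun v a hv => h' v a (h v a hv)

theorem State.Le.eq_none {s s' : State n} (h : s.Le s') {v : Fin n} (hv : s'.anc v = none) :
    s.anc v = none := by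
  cases hs : s.anc v with
  | none => rfl
  | some a => rw [h v a hs] at hv; exact absurd hv (by simp)

theorem State.Le.ne_none {s s' : State n} (h : s.Le s') {v : Fin n} (hv : s.anc v ≠ none) :
    s'.anc v ≠ none := fun h' => hv (h.eq_none h')

/-- The set of the vertices that have not been seen yet. -/
def State.unseen (s : State n) : Finset (Fin n) := Finset.univ.filter fun v => s.anc v = none

@[simp] theorem State.mem_unseen {s : State n} {v : Fin n} : v ∈ s.unseen ↔ s.anc v = none := by
  simp [State.unseen]

theorem State.Le.unseen_subset {s s' : State n} (h : s.Le s') : s'.unseen ⊆ s.unseen :=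
  fun v hv => by simpa using h.eq_none (by simpa using hv)

theorem State.le_discover {s : State n} {v : Fin n} (hv : s.anc v = none) (a : List (Fin n)) :
    s.Le (s.discover v a) := by
  intro w b hw
  have : w ≠ v := by rintro rfl; rw [hv] at hw; exact absurd hw (by simp)
  simpa [State.discover, this] using hw

@[simp] theorem State.discover_anc_self (s : State n) (v : Fin n) (a : List (Fin n)) :
    (s.discover v a).anc v = some a := by simp [State.discover]

theorem State.unseen_discover (s : State n) (v : Fin n) (a : List (Fin n)) :
    (s.discover v a).unseen = s.unseen.erase v := by
  ext w
  by_cases hw : w = v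
  · subst hw; simp
  · simp [State.discover, hw]

theorem State.card_unseen_discover {s : State n} {v : Fin n} (hv : s.anc v = none)
    (a : List (Fin n)) : (s.discover v a).unseen.card + 1 = s.unseen.card := by
  rw [State.unseen_discover]
  exact Finset.card_erase_add_one (by simpa using hv)

theorem State.card_unseen_lt {s : State n} {v : Fin n} (hv : s.anc v ≠ none) :
    s.unseen.card < n := by
  have : s.unseen.card < (Finset.univ : Finset (Fin n)).card :=
    Finset.card_lt_card (Finset.ssubset_univ_iff.2 fun h => hv (by
      simpa using (h ▸ Finset.mem_univ v : v ∈ s.unseen)))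
  simpa using this

/-- Explore the arcs from `u` to the vertices in the list `l`, one by one. -/
def explore (g : Arcs n) (d : ℕ) (u : Fin n) (l : List (Fin n)) (s : State n) : State n :=
  l.foldl (fun s v =>
      match s.anc v with
      | some _ => s.record u v
      | none => visit g d v ((s.record u v).discover v (u :: (s.anc u).getD []))) s

theorem visit_succ (g : Arcs n) (d : ℕ) (u : Fin n) (s : State n) :
    visit g (d + 1) u s = explore g d u (g u) s := rfl

theorem explore_cons_of_seen (g : Arcs n) (d : ℕ) (u v : Fin n) (l : List (Fin n)) {s : State n}
    (hv : s.anc v ≠ none) : explore g d u (v :: l) s = explore g d u l (s.record u v) := by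
  obtain ⟨a, ha⟩ := Option.ne_none_iff_exists'.1 hv
  simp [explore, ha]

theorem explore_cons_of_unseen (g : Arcs n) (d : ℕ) (u v : Fin n) (l : List (Fin n)) {s : State n}
    (hv : s.anc v = none) : explore g d u (v :: l) s =
      explore g d u l
        (visit g d v ((s.record u v).discover v (u :: (s.anc u).getD []))) := by
  simp [explore, hv]

theorem le_visit (g : Arcs n) (d : ℕ) (u : Fin n) (s : State n) : s.Le (visit g d u s) := by
  induction d generalizing u s with
  | zero => exact State.Le.refl s
  | succ d ih =>
    rw [visit_succ]
    generalize g u = l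
    induction l generalizing s with
    | nil => exact State.Le.refl s
    | cons v l ihl =>
      by_cases hv : s.anc v = none
      · rw [explore_cons_of_unseen _ _ _ _ _ hv]
        exact (State.le_discover (s := s.record u v) hv _).trans ((ih _ _).trans (ihl _))
      · rw [explore_cons_of_seen _ _ _ _ _ hv]
        exact ihl (s.record u v)

theorem explore_congr_of_visit {d d' : ℕ} {g g' : Arcs n} {u : Fin n} {s : State n}
    (H : ∀ v s', s.Le s' → s.anc v = none → s'.unseen.card < s.unseen.card →
      visit g d v s' = visit g' d' v s') (l : List (Fin n)) {s₁ : State n} (hs : s.Le s₁) :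
    explore g d u l s₁ = explore g' d' u l s₁ := by
  induction l generalizing s₁ with
  | nil => rfl
  | cons v l ih =>
    by_cases hv : s₁.anc v = none
    · rw [explore_cons_of_unseen _ _ _ _ _ hv, explore_cons_of_unseen _ _ _ _ _ hv]
      have h1 := State.le_discover (s := s₁.record u v) hv (u :: (s₁.anc u).getD [])
      have h2 := State.card_unseen_discover (s := s₁.record u v) hv (u :: (s₁.anc u).getD [])
      have h3 := Finset.card_le_card hs.unseen_subset
      have h4 : (s₁.record u v).unseen = s₁.unseen := rfl
      rw [H v _ (hs.trans h1) (hs.eq_none hv) (by rw [h4] at h2; omega)]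
      exact ih ((hs.trans h1).trans (le_visit _ _ _ _))
    · rw [explore_cons_of_seen _ _ _ _ _ hv, explore_cons_of_seen _ _ _ _ _ hv]
      exact ih (s₁ := s₁.record u v) hs

/-- A visit of `u` depends only on the arcs from `u` and from the unseen vertices, and not on the
bound for the depth, as long as this exceeds the number of unseen vertices. -/
theorem visit_congr {d d' : ℕ} {g g' : Arcs n} {u : Fin n} {s : State n}
    (hd : s.unseen.card < d) (hd' : s.unseen.card < d') (hu : g u = g' u)
    (hg : ∀ v, s.anc v = none → g v = g' v) : visit g d u s = visit g' d' u s := by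
  induction d generalizing d' u s with
  | zero => omega
  | succ d ih =>
    obtain _ | d' := d'
    · omega
    rw [visit_succ, visit_succ, ← hu]
    refine explore_congr_of_visit (fun v s' hs hv hlt => ?_) _ (State.Le.refl s)
    exact ih (by omega) (by omega) (hg v hv) fun w hw => hg w (hs.eq_none hw)

theorem explore_congr {d d' : ℕ} {g g' : Arcs n} {u : Fin n} {s : State n}
    (hd : s.unseen.card ≤ d) (hd' : s.unseen.card ≤ d')
    (hg : ∀ v, s.anc v = none → g v = g' v) (l : List (Fin n)) :
    explore g d u l s = explore g' d' u l s :=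
  explore_congr_of_visit (fun v s' hs hv hlt => visit_congr (by omega) (by omega) (hg v hv)
    fun w hw => hg w (hs.eq_none hw)) l (State.Le.refl s)

/-- Start new trees at those vertices of the list `l` that turn out to be unseen. -/
def searchFrom (g : Arcs n) (l : List (Fin n)) (s : State n) : State n :=
  l.foldl (fun s r =>
    match s.anc r with
    | some _ => s
    | none => visit g n r (s.discover r [])) s

theorem searchFrom_cons_of_seen (g : Arcs n) (r : Fin n) (l : List (Fin n)) {s : State n}
    (hr : s.anc r ≠ none) : searchFrom g (r :: l) s = searchFrom g l s := by
  obtain ⟨a, ha⟩ := Option.ne_none_iff_exists'.1 hr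
  simp [searchFrom, ha]

theorem searchFrom_cons_of_unseen (g : Arcs n) (r : Fin n) (l : List (Fin n)) {s : State n}
    (hr : s.anc r = none) :
    searchFrom g (r :: l) s = searchFrom g l (visit g n r (s.discover r [])) := by
  simp [searchFrom, hr]

theorem searchFrom_append_of_seen (g : Arcs n) (l l' : List (Fin n)) {s : State n}
    (h : ∀ r ∈ l, s.anc r ≠ none) : searchFrom g (l ++ l') s = searchFrom g l' s := by
  induction l with
  | nil => rfl
  | cons r l ih =>
    rw [List.cons_append, searchFrom_cons_of_seen g _ _ (h r (by simp))]
    exact ih fun r' hr' => h r' (by simp [hr'])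

theorem searchFrom_congr {g g' : Arcs n} {s : State n} (hg : ∀ v, s.anc v = none → g v = g' v)
    (l : List (Fin n)) : searchFrom g l s = searchFrom g' l s := by
  induction l generalizing s with
  | nil => rfl
  | cons r l ih =>
    by_cases hr : s.anc r = none
    · rw [searchFrom_cons_of_unseen _ _ _ hr, searchFrom_cons_of_unseen _ _ _ hr]
      have h1 := State.le_discover hr []
      have h2 : (s.discover r []).unseen.card < n := State.card_unseen_lt (v := r) (by simp)
      rw [visit_congr h2 h2 (hg r hr) fun v hv => hg v (h1.eq_none hv)]
      exact ih fun v hv => hg v ((h1.trans (le_visit _ _ _ _)).eq_none hv)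
    · rw [searchFrom_cons_of_seen _ _ _ hr, searchFrom_cons_of_seen _ _ _ hr]
      exact ih hg

/-! ### The search as a sequence of steps -/

/-- The rest of a search that is interrupted in state `s` while the vertices of the list `st` (from
the current vertex up to the root of its tree) are being explored; here `g v` is the list of the arcs
from `v` that have not been explored yet. -/
def finish (g : Arcs n) : List (Fin n) → State n → State n
  | [], s => searchFrom g (List.finRange n) s
  | u :: st, s => finish g st (visit g n u s)

theorem finish_congr {g g' : Arcs n} {st : List (Fin n)} {s : State n}
    (hst : ∀ u ∈ st, s.anc u ≠ none) (h : ∀ u ∈ st, g u = g' u)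
    (hg : ∀ v, s.anc v = none → g v = g' v) : finish g st s = finish g' st s := by
  induction st generalizing s with
  | nil => exact searchFrom_congr hg _
  | cons u st ih =>
    have h2 : s.unseen.card < n := State.card_unseen_lt (hst u (by simp))
    rw [finish, finish, visit_congr h2 h2 (h u (by simp)) hg]
    have h1 := le_visit g' n u s
    exact ih (fun v hv => h1.ne_none (hst v (by simp [hv]))) (fun v hv => h v (by simp [hv]))
      fun v hv => hg v (h1.eq_none hv)

theorem visit_eq_explore (g : Arcs n) (u : Fin n) (s : State n) :
    visit g n u s = explore g (n - 1) u (g u) s := by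
  obtain ⟨d, rfl⟩ : ∃ d, n = d + 1 := ⟨n - 1, by have := u.isLt; omega⟩
  rfl

theorem finish_cons_of_eq_nil {g : Arcs n} {u : Fin n} (h : g u = []) (st : List (Fin n))
    (s : State n) : finish g (u :: st) s = finish g st s := by
  rw [finish, visit_eq_explore, h]
  rfl

theorem finish_cons_of_seen {g : Arcs n} {u v : Fin n} {l st : List (Fin n)} {s : State n}
    (hst : ∀ w ∈ u :: st, s.anc w ≠ none) (hnd : (u :: st).Nodup) (h : g u = v :: l)
    (hv : s.anc v ≠ none) :
    finish g (u :: st) s = finish (Function.update g u l) (u :: st) (s.record u v) := by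
  have hu := hst u (by simp)
  have hlt := State.card_unseen_lt hu
  have hg : ∀ w, s.anc w = none → g w = Function.update g u l w := fun w hw => by
    rw [Function.update_of_ne]; rintro rfl; exact hu hw
  rw [finish, finish, visit_eq_explore, visit_eq_explore, h, explore_cons_of_seen _ _ _ _ _ hv,
    Function.update_self,
    explore_congr (s := s.record u v) (g' := Function.update g u l) (d' := n - 1)
      (by change s.unseen.card ≤ _; omega) (by change s.unseen.card ≤ _; omega) hg]
  have hle : s.Le (explore (Function.update g u l) (n - 1) u l (s.record u v)) := by
    have := le_visit (Function.update g u l) n u (s.record u v)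
    rw [visit_eq_explore, Function.update_self] at this
    exact this
  refine finish_congr (fun w hw => hle.ne_none (hst w (by simp [hw]))) (fun w hw => ?_)
    fun w hw => hg w (hle.eq_none hw)
  rw [Function.update_of_ne]
  rintro rfl
  exact (List.nodup_cons.1 hnd).1 hw

theorem finish_cons_of_unseen {g : Arcs n} {u v : Fin n} {l st : List (Fin n)} {s : State n}
    (hst : ∀ w ∈ u :: st, s.anc w ≠ none) (hnd : (u :: st).Nodup) (h : g u = v :: l)
    (hv : s.anc v = none) :
    finish g (u :: st) s = finish (Function.update g u l) (v :: u :: st)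
      ((s.record u v).discover v (u :: (s.anc u).getD [])) := by
  have hu := hst u (by simp)
  have hlt := State.card_unseen_lt hu
  have hg : ∀ w, s.anc w = none → g w = Function.update g u l w := fun w hw => by
    rw [Function.update_of_ne]; rintro rfl; exact hu hw
  set s₁ := (s.record u v).discover v (u :: (s.anc u).getD []) with hs₁
  have h1 : s.Le s₁ := State.le_discover (s := s.record u v) hv _
  have h2 : s₁.unseen.card + 1 = s.unseen.card := State.card_unseen_discover (s := s.record u v) hv _
  rw [finish, finish, finish, visit_eq_explore, h, explore_cons_of_unseen _ _ _ _ _ hv, ← hs₁,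
    visit_congr (s := s₁) (g' := Function.update g u l) (d' := n) (by omega) (by omega) (hg v hv)
      fun w hw => hg w (h1.eq_none hw)]
  have h3 := h1.trans (le_visit (Function.update g u l) n v s₁)
  set s₂ := visit (Function.update g u l) n v s₁
  have h4 := Finset.card_le_card h3.unseen_subset
  rw [visit_eq_explore _ u s₂, Function.update_self,
    explore_congr (s := s₂) (g' := Function.update g u l) (d' := n - 1)
      (by omega) (by omega) fun w hw => hg w (h3.eq_none hw)]
  have hle := h3.trans (le_visit (Function.update g u l) n u s₂)
  rw [visit_eq_explore _ u s₂, Function.update_self] at hle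
  refine finish_congr (fun w hw => hle.ne_none (hst w (by simp [hw]))) (fun w hw => ?_)
    fun w hw => hg w (hle.eq_none hw)
  rw [Function.update_of_ne]
  rintro rfl
  exact (List.nodup_cons.1 hnd).1 hw

theorem finish_nil_of_unseen_eq_empty (g : Arcs n) {s : State n} (hs : s.unseen = ∅) :
    finish g [] s = s := by
  have := searchFrom_append_of_seen g (List.finRange n) [] (s := s) fun r _ hr => by
    have : r ∈ s.unseen := by simpa using hr
    simp [hs] at this
  simpa [finish, searchFrom] using this

theorem exists_finish_nil_eq {s : State n} (hs : s.unseen ≠ ∅) :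
    ∃ r, s.anc r = none ∧ ∀ g : Arcs n, finish g [] s = finish g [r] (s.discover r []) := by
  obtain ⟨v, hv⟩ := Finset.nonempty_iff_ne_empty.2 hs
  obtain ⟨r, l₁, l₂, h1, h2, h3⟩ : ∃ (r : Fin n) (l₁ l₂ : List (Fin n)),
      (∀ w ∈ l₁, s.anc w ≠ none) ∧ s.anc r = none ∧ List.finRange n = l₁ ++ r :: l₂ := by
    have hv' : (List.finRange n).find? (fun w => (s.anc w).isNone) ≠ none := by
      intro h
      rw [List.find?_eq_none] at h
      exact h v (List.mem_finRange v) (by simpa using hv)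
    obtain ⟨r, hr⟩ := Option.ne_none_iff_exists'.1 hv'
    obtain ⟨h, l₁, l₂, h3, h1⟩ := List.find?_eq_some_iff_append.1 hr
    exact ⟨r, l₁, l₂, fun w hw => by simpa [← Option.isSome_iff_ne_none] using h1 w hw,
      by simpa using h, h3⟩
  refine ⟨r, h2, fun g => ?_⟩
  have h4 := (State.le_discover h2 []).trans (le_visit g n r (s.discover r []))
  have h5 := (le_visit g n r (s.discover r [])).ne_none (v := r) (by simp)
  rw [finish, finish, finish, h3, searchFrom_append_of_seen g _ _ h1,
    searchFrom_append_of_seen g _ _ fun w hw => h4.ne_none (h1 w hw),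
    searchFrom_cons_of_unseen _ _ _ h2, searchFrom_cons_of_seen _ _ _ h5]

theorem search_eq_finish (g : Arcs n) :
    search g = finish g [] ⟨fun _ => none, fun _ => 0⟩ := rfl

/-! ### The counts -/

/-- Add `c` to the counts. -/
def State.addCount (s : State n) (c : ArcType → ℕ) : State n := ⟨s.anc, s.count + c⟩

theorem State.record_addCount (s : State n) (c : ArcType → ℕ) (u v : Fin n) :
    (s.addCount c).record u v = (s.record u v).addCount c := by
  change State.mk _ _ = State.mk _ _
  congr 1
  ext k
  change (if k = s.arcType u v then s.count k + c k + 1 else s.count k + c k) =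
    (if k = s.arcType u v then s.count k + 1 else s.count k) + c k
  split_ifs <;> omega

theorem visit_addCount (g : Arcs n) (c : ArcType → ℕ) (d : ℕ) (u : Fin n) (s : State n) :
    visit g d u (s.addCount c) = (visit g d u s).addCount c := by
  induction d generalizing u s with
  | zero => rfl
  | succ d ih =>
    rw [visit_succ, visit_succ]
    generalize g u = l
    induction l generalizing s with
    | nil => rfl
    | cons v l ihl =>
      by_cases hv : s.anc v = none
      · rw [explore_cons_of_unseen _ _ _ _ _ hv, explore_cons_of_unseen _ _ _ _ _
          (s := s.addCount c) hv, ← ihl, ← ih, State.record_addCount]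
        rfl
      · rw [explore_cons_of_seen _ _ _ _ _ hv, explore_cons_of_seen _ _ _ _ _
          (s := s.addCount c) hv, ← ihl, State.record_addCount]

theorem searchFrom_addCount (g : Arcs n) (c : ArcType → ℕ) (l : List (Fin n)) (s : State n) :
    searchFrom g l (s.addCount c) = (searchFrom g l s).addCount c := by
  induction l generalizing s with
  | nil => rfl
  | cons r l ih =>
    by_cases hr : s.anc r = none
    · rw [searchFrom_cons_of_unseen _ _ _ hr, searchFrom_cons_of_unseen _ _ _
        (s := s.addCount c) hr, ← ih, ← visit_addCount]
      rfl
    · rw [searchFrom_cons_of_seen _ _ _ hr, searchFrom_cons_of_seen _ _ _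
        (s := s.addCount c) hr, ← ih]

theorem finish_addCount (g : Arcs n) (c : ArcType → ℕ) (st : List (Fin n)) (s : State n) :
    finish g st (s.addCount c) = (finish g st s).addCount c := by
  induction st generalizing s with
  | nil => exact searchFrom_addCount g c _ s
  | cons u st ih => rw [finish, finish, visit_addCount, ih]

/-! ### Generating functions of trees and forests -/

/-- If the strictly upper triangular kernel `T` and the units `D` define `P` by decomposition at the
last jump, then `P` can also be decomposed at the first jump: both say that `P` is the inverse of the
triangular matrix `diag D - T`. -/
theorem first_step_of_last_step {R : Type*} [CommRing R] {D : ℕ → R} {T P : ℕ → ℕ → R}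
    (hD : ∀ j, IsUnit (D j))
    (hP : ∀ i j, i ≤ j →
      D j * P i j = (if i = j then 1 else 0) + ∑ m ∈ Finset.Ico i j, P i m * T m j)
    {i j : ℕ} (hij : i ≤ j) :
    D i * P i j = (if i = j then 1 else 0) + ∑ m ∈ Finset.Ioc i j, T i m * P m j := by
  induction j using Nat.strong_induction_on with
  | _ j ih =>
    obtain rfl | hlt := hij.eq_or_lt
    · simpa using hP i i le_rfl
    refine (hD j).mul_left_cancel ?_
    have h1 : D j * (D i * P i j) = T i j +
        ∑ m ∈ Finset.Ico i j, ∑ l ∈ Finset.Ioc i m, T i l * P l m * T m j := by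
      calc D j * (D i * P i j) = D i * (D j * P i j) := by ring
        _ = ∑ m ∈ Finset.Ico i j, (D i * P i m) * T m j := by
          rw [hP i j hij, if_neg hlt.ne, zero_add, Finset.mul_sum]
          simp only [mul_assoc]
        _ = ∑ m ∈ Finset.Ico i j, ((if i = m then T m j else 0) +
              ∑ l ∈ Finset.Ioc i m, T i l * P l m * T m j) := by
          refine Finset.sum_congr rfl fun m hm => ?_
          rw [Finset.mem_Ico] at hm
          rw [ih m hm.2 hm.1, add_mul, Finset.sum_mul]
          simp
        _ = _ := by
          rw [Finset.sum_add_distrib, Finset.sum_ite_eq, if_pos (by simpa using hlt)]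
    have h2 : D j * ((if i = j then 1 else 0) + ∑ l ∈ Finset.Ioc i j, T i l * P l j) = T i j +
        ∑ l ∈ Finset.Ioc i j, ∑ m ∈ Finset.Ico l j, T i l * P l m * T m j := by
      calc D j * ((if i = j then 1 else 0) + ∑ l ∈ Finset.Ioc i j, T i l * P l j)
          = ∑ l ∈ Finset.Ioc i j, T i l * (D j * P l j) := by
            rw [if_neg hlt.ne, zero_add, Finset.mul_sum]
            exact Finset.sum_congr rfl fun l _ => by ring
        _ = ∑ l ∈ Finset.Ioc i j, ((if l = j then T i l else 0) +
              ∑ m ∈ Finset.Ico l j, T i l * P l m * T m j) := by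
          refine Finset.sum_congr rfl fun l hl => ?_
          rw [Finset.mem_Ioc] at hl
          rw [hP l j hl.2, mul_add, Finset.mul_sum]
          simp [mul_assoc]
        _ = _ := by
          rw [Finset.sum_add_distrib, Finset.sum_ite_eq', if_pos (by simpa using hlt)]
    rw [h1, h2]
    congr 1
    refine Finset.sum_comm' fun m l => ?_
    simp only [Finset.mem_Ico, Finset.mem_Ioc]
    omega

/-- The generating function of the ways to explore a tree with `n` vertices, apart from the labels of
the vertices and the marks of the tree arcs: loops are marked by `w`, forward arcs by `x`, back arcs
by `y` and cross arcs by `z`. The tree is split at the last child of the root; when this child is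
discovered, its tree sees one ancestor and `m - 1` other vertices, so that each of its vertices has
additional back and cross arcs, marked by `y + (m - 1) z`. -/
noncomputable def treeGF (x y z : MvPowerSeries σ ℚ) (n : ℕ) (w : MvPowerSeries σ ℚ) :
    MvPowerSeries σ ℚ :=
  if n = 1 then (1 - w)⁻¹
  else (1 - w - ((n : MvPowerSeries σ ℚ) - 1) * x)⁻¹ *
    ∑ m : Finset.Ico 1 n, treeGF x y z m w *
      treeGF x y z (n - m) (w + y + ((m : MvPowerSeries σ ℚ) - 1) * z)
termination_by n
decreasing_by all_goals (have := Finset.mem_Ico.1 m.2; omega)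

theorem treeGF_one (x y z w : MvPowerSeries σ ℚ) : treeGF x y z 1 w = (1 - w)⁻¹ := by
  rw [treeGF, if_pos rfl]

theorem treeGF_of_ne_one (x y z : MvPowerSeries σ ℚ) {n : ℕ} (hn : n ≠ 1)
    (w : MvPowerSeries σ ℚ) :
    treeGF x y z n w = (1 - w - ((n : MvPowerSeries σ ℚ) - 1) * x)⁻¹ *
      ∑ m ∈ Finset.Ico 1 n, treeGF x y z m w *
        treeGF x y z (n - m) (w + y + ((m : MvPowerSeries σ ℚ) - 1) * z) := by
  rw [treeGF, if_neg hn]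
  congr 1
  exact Finset.sum_coe_sort (Finset.Ico 1 n) fun m : ℕ => treeGF x y z m w *
    treeGF x y z (n - m) (w + y + ((m : MvPowerSeries σ ℚ) - 1) * z)

/-- The generating function of the ways to complete a tree whose root is the current vertex, from `i`
vertices to `j` vertices. -/
noncomputable def partialTreeGF (x y z w : MvPowerSeries σ ℚ) (i j : ℕ) : MvPowerSeries σ ℚ :=
  (1 - w - ((j : MvPowerSeries σ ℚ) - 1) * x)⁻¹ * ((if i = j then 1 else 0) +
    ∑ m : Finset.Ico i j, partialTreeGF x y z w i m *
      treeGF x y z (j - m) (w + y + ((m : MvPowerSeries σ ℚ) - 1) * z))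
termination_by j
decreasing_by all_goals (have := Finset.mem_Ico.1 m.2; omega)

theorem partialTreeGF_eq (x y z w : MvPowerSeries σ ℚ) (i j : ℕ) :
    partialTreeGF x y z w i j =
      (1 - w - ((j : MvPowerSeries σ ℚ) - 1) * x)⁻¹ * ((if i = j then 1 else 0) +
        ∑ m ∈ Finset.Ico i j, partialTreeGF x y z w i m *
          treeGF x y z (j - m) (w + y + ((m : MvPowerSeries σ ℚ) - 1) * z)) := by
  rw [partialTreeGF]
  congr 2
  exact Finset.sum_coe_sort (Finset.Ico i j) fun m : ℕ => partialTreeGF x y z w i m *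
    treeGF x y z (j - m) (w + y + ((m : MvPowerSeries σ ℚ) - 1) * z)

theorem partialTreeGF_one (x y z w : MvPowerSeries σ ℚ) {j : ℕ} (hj : 1 ≤ j) :
    partialTreeGF x y z w 1 j = treeGF x y z j w := by
  induction j using Nat.strong_induction_on with
  | _ j ih =>
    rw [partialTreeGF_eq]
    obtain rfl | hne := eq_or_ne j 1
    · simp [treeGF_one]
    · rw [treeGF_of_ne_one _ _ _ hne, if_neg hne.symm, zero_add]
      congr 1
      refine Finset.sum_congr rfl fun m hm => ?_
      rw [Finset.mem_Ico] at hm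
      rw [ih m hm.2 hm.1]

theorem constantCoeff_loop_factor {w x : MvPowerSeries σ ℚ} (hw : constantCoeff w = 0)
    (hx : constantCoeff x = 0) (c : MvPowerSeries σ ℚ) :
    constantCoeff (1 - w - c * x) = 1 := by
  simp [hw, hx]

theorem loop_factor_mul_partialTreeGF {x y z w : MvPowerSeries σ ℚ} (hw : constantCoeff w = 0)
    (hx : constantCoeff x = 0) {i j : ℕ} (hij : i ≤ j) :
    (1 - w - ((i : MvPowerSeries σ ℚ) - 1) * x) * partialTreeGF x y z w i j =
      (if i = j then 1 else 0) + ∑ m ∈ Finset.Ioc i j,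
        treeGF x y z (m - i) (w + y + ((i : MvPowerSeries σ ℚ) - 1) * z) *
          partialTreeGF x y z w m j := by
  refine first_step_of_last_step (D := fun i : ℕ => 1 - w - ((i : MvPowerSeries σ ℚ) - 1) * x)
    (T := fun i m => treeGF x y z (m - i) (w + y + ((i : MvPowerSeries σ ℚ) - 1) * z))
    (fun j => ?_) (fun i j hij => ?_) hij
  · rw [MvPowerSeries.isUnit_iff_constantCoeff, constantCoeff_loop_factor hw hx]
    exact isUnit_one
  · rw [partialTreeGF_eq, ← mul_assoc, MvPowerSeries.mul_inv_cancel _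
      (by rw [constantCoeff_loop_factor hw hx]; exact one_ne_zero), one_mul]

/-- The generating function of the ways to explore a forest on `r` vertices, divided by `r !`: as
`treeGF`, but with labels, and with the tree arcs marked by `t`. The root of the first tree is the
vertex with the smallest label, which accounts for the factor `1 / r`; each of the vertices after the
first tree, with `k` vertices, has `k` additional cross arcs. -/
noncomputable def forestGF (x y z t : MvPowerSeries σ ℚ) (r : ℕ) (w : MvPowerSeries σ ℚ) :
    MvPowerSeries σ ℚ :=
  if r = 0 then 1
  else C (r : ℚ)⁻¹ * ∑ k : Finset.Icc 1 r, t ^ (k - 1 : ℕ) * treeGF x y z k w *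
    forestGF x y z t (r - k) (w + (k : MvPowerSeries σ ℚ) * z)
termination_by r
decreasing_by all_goals (have := Finset.mem_Icc.1 k.2; omega)

theorem forestGF_zero (x y z t w : MvPowerSeries σ ℚ) : forestGF x y z t 0 w = 1 := by
  rw [forestGF, if_pos rfl]

theorem forestGF_of_ne_zero (x y z t : MvPowerSeries σ ℚ) {r : ℕ} (hr : r ≠ 0)
    (w : MvPowerSeries σ ℚ) :
    forestGF x y z t r w =
      C (r : ℚ)⁻¹ * ∑ k ∈ Finset.Icc 1 r, t ^ (k - 1) * treeGF x y z k w *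
        forestGF x y z t (r - k) (w + (k : MvPowerSeries σ ℚ) * z) := by
  rw [forestGF, if_neg hr]
  congr 1
  exact Finset.sum_coe_sort (Finset.Icc 1 r) fun k : ℕ => t ^ (k - 1 : ℕ) * treeGF x y z k w *
    forestGF x y z t (r - k) (w + (k : MvPowerSeries σ ℚ) * z)

theorem natCast_mul_forestGF (x y z t : MvPowerSeries σ ℚ) {r : ℕ} (hr : r ≠ 0)
    (w : MvPowerSeries σ ℚ) :
    (r : MvPowerSeries σ ℚ) * forestGF x y z t r w =
      ∑ k ∈ Finset.Icc 1 r, t ^ (k - 1) * treeGF x y z k w *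
        forestGF x y z t (r - k) (w + (k : MvPowerSeries σ ℚ) * z) := by
  rw [forestGF_of_ne_zero _ _ _ _ hr, ← mul_assoc, ← map_natCast (C (σ := σ) (R := ℚ)) r, ← map_mul,
    mul_inv_cancel₀ (by exact_mod_cast hr), map_one, one_mul]

/-- The generating function of the rest of a search on `n` vertices that is interrupted when `S`
vertices have been seen, divided by the factorial of the number of unseen vertices. The list contains,
for the current vertex and then for its ancestors up to the root, how many vertices had been seen
before. -/
noncomputable def stackGF (w x y z t : MvPowerSeries σ ℚ) (n : ℕ) :
    List ℕ → ℕ → MvPowerSeries σ ℚ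
  | [], S => forestGF x y z t (n - S) (w + (S : MvPowerSeries σ ℚ) * z)
  | a :: as, S => ∑ S' ∈ Finset.Icc S n, t ^ (S' - S) *
      partialTreeGF x y z (w + (as.length : MvPowerSeries σ ℚ) * y +
        ((a : MvPowerSeries σ ℚ) - (as.length : MvPowerSeries σ ℚ)) * z) (S - a) (S' - a) *
      stackGF w x y z t n as S'

theorem natCast_mul_stackGF_nil (w x y z t : MvPowerSeries σ ℚ) {n S : ℕ} (hS : S < n) :
    ((n - S : ℕ) : MvPowerSeries σ ℚ) * stackGF w x y z t n [] S =
      stackGF w x y z t n [S] (S + 1) := by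
  rw [stackGF, natCast_mul_forestGF _ _ _ _ (by omega), stackGF]
  refine Finset.sum_bij' (fun k _ => S + k) (fun S' _ => S' - S) ?_ ?_ ?_ ?_ ?_
  · intro k hk; simp only [Finset.mem_Icc] at hk ⊢; omega
  · intro k hk; simp only [Finset.mem_Icc] at hk ⊢; omega
  · intro k hk; simp
  · intro k hk; simp only [Finset.mem_Icc] at hk ⊢; omega
  · intro k hk
    simp only [Finset.mem_Icc] at hk
    rw [stackGF, show S + 1 - S = 1 by omega, show S + k - S = k by omega,
      show S + k - (S + 1) = k - 1 by omega, partialTreeGF_one _ _ _ _ hk.1,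
      show n - (S + k) = n - S - k by omega]
    simp only [List.length_nil, Nat.cast_zero, zero_mul, add_zero, sub_zero, Nat.cast_add, add_mul,
      add_assoc]

/-- The next step of the current vertex is either to stop or to discover a new vertex, unless it is
an arc to one of the vertices that have been seen. -/
theorem loop_factor_mul_stackGF_cons {w x y z : MvPowerSeries σ ℚ} (t : MvPowerSeries σ ℚ)
    (hw : constantCoeff w = 0) (hx : constantCoeff x = 0) (hy : constantCoeff y = 0)
    (hz : constantCoeff z = 0) {n S a : ℕ} (as : List ℕ) (haS : a < S) (hS : S ≤ n) :
    (1 - (w + (as.length : MvPowerSeries σ ℚ) * y +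
        ((a : MvPowerSeries σ ℚ) - (as.length : MvPowerSeries σ ℚ)) * z) -
        (((S - a : ℕ) : MvPowerSeries σ ℚ) - 1) * x) * stackGF w x y z t n (a :: as) S =
      stackGF w x y z t n as S + t * stackGF w x y z t n (S :: a :: as) (S + 1) := by
  set w' := w + (as.length : MvPowerSeries σ ℚ) * y +
        ((a : MvPowerSeries σ ℚ) - (as.length : MvPowerSeries σ ℚ)) * z with hw'
  have hw'0 : constantCoeff w' = 0 := by simp [hw', hw, hy, hz]
  have key : ∀ S' ∈ Finset.Icc S n,
      (1 - w' - (((S - a : ℕ) : MvPowerSeries σ ℚ) - 1) * x) *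
        (t ^ (S' - S) * partialTreeGF x y z w' (S - a) (S' - a) * stackGF w x y z t n as S') =
      (if S = S' then stackGF w x y z t n as S' else 0) +
      ∑ S'' ∈ Finset.Ioc S S', t * (t ^ (S'' - (S + 1)) *
        treeGF x y z (S'' - S) (w' + y + (((S - a : ℕ) : MvPowerSeries σ ℚ) - 1) * z) *
        (t ^ (S' - S'') * partialTreeGF x y z w' (S'' - a) (S' - a) *
          stackGF w x y z t n as S')) := by
    intro S' hS'
    rw [Finset.mem_Icc] at hS'
    calc _ = t ^ (S' - S) * ((1 - w' - (((S - a : ℕ) : MvPowerSeries σ ℚ) - 1) * x) *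
          partialTreeGF x y z w' (S - a) (S' - a)) * stackGF w x y z t n as S' := by ring
      _ = _ := by
        rw [loop_factor_mul_partialTreeGF hw'0 hx (by omega), mul_add, add_mul, Finset.mul_sum,
          Finset.sum_mul]
        congr 1
        · obtain rfl | hne := eq_or_ne S S'
          · simp
          · rw [if_neg hne, if_neg (by omega)]; simp
        · refine Finset.sum_bij' (fun m _ => m + a) (fun S'' _ => S'' - a) ?_ ?_ ?_ ?_ ?_
          · intro k hk; simp only [Finset.mem_Ioc] at hk ⊢; omega
          · intro k hk; simp only [Finset.mem_Ioc] at hk ⊢; omega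
          · intro k hk; simp
          · intro k hk; simp only [Finset.mem_Ioc] at hk ⊢; omega
          · intro m hm
            simp only [Finset.mem_Ioc] at hm
            rw [show m + a - S = m - (S - a) by omega, show m + a - a = m by omega]
            have : t ^ (S' - S) = t * t ^ (m + a - (S + 1)) * t ^ (S' - (m + a)) := by
              rw [← pow_succ', ← pow_add]; congr 1; omega
            rw [this]
            ring
  rw [stackGF, Finset.mul_sum, Finset.sum_congr rfl key, Finset.sum_add_distrib,
    Finset.sum_ite_eq, if_pos (by simpa using hS)]
  congr 1
  rw [stackGF, Finset.mul_sum, Finset.sum_comm' (t' := Finset.Icc (S + 1) n)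
    (s' := fun S'' => Finset.Icc S'' n)
    (by intro b c; simp only [Finset.mem_Icc, Finset.mem_Ioc]; omega)]
  refine Finset.sum_congr rfl fun S'' hS'' => ?_
  rw [Finset.mem_Icc] at hS''
  rw [← Finset.mul_sum, ← Finset.mul_sum, stackGF, ← hw', show S + 1 - S = 1 by omega,
    partialTreeGF_one _ _ _ _ (by omega)]
  congr 4
  rw [hw', Nat.cast_sub haS.le, List.length_cons]
  push_cast
  ring

/-! ### Change of variables -/

theorem map_inv_of_constantCoeff {φ : MvPowerSeries σ ℚ →+* MvPowerSeries τ ℚ}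
    {f : MvPowerSeries σ ℚ} (hf : constantCoeff f ≠ 0) (hφ : constantCoeff (φ f) ≠ 0) :
    φ f⁻¹ = (φ f)⁻¹ := by
  rw [MvPowerSeries.eq_inv_iff_mul_eq_one hφ, ← map_mul, MvPowerSeries.inv_mul_cancel _ hf, map_one]

theorem map_treeGF {φ : MvPowerSeries σ ℚ →+* MvPowerSeries τ ℚ}
    (hφ : ∀ f, constantCoeff f = 0 → constantCoeff (φ f) = 0) {x y z w : MvPowerSeries σ ℚ}
    (hw : constantCoeff w = 0) (hx : constantCoeff x = 0) (hy : constantCoeff y = 0)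
    (hz : constantCoeff z = 0) (n : ℕ) :
    φ (treeGF x y z n w) = treeGF (φ x) (φ y) (φ z) n (φ w) := by
  induction n using Nat.strong_induction_on generalizing w with
  | _ n ih =>
    have h1 : ∀ f, constantCoeff f = 0 → φ (1 - f)⁻¹ = (1 - φ f)⁻¹ := fun f hf => by
      rw [map_inv_of_constantCoeff, map_sub, map_one]
      · simp [hf]
      · simp [hφ f hf]
    obtain rfl | hn := eq_or_ne n 1
    · rw [treeGF_one, treeGF_one, h1 w hw]
    · rw [treeGF_of_ne_one _ _ _ hn, treeGF_of_ne_one _ _ _ hn, map_mul, sub_sub,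
        h1 _ (by simp [hw, hx]),
        map_sum, sub_sub]
      congr 1
      · simp
      · refine Finset.sum_congr rfl fun m hm => ?_
        rw [Finset.mem_Ico] at hm
        rw [map_mul, ih m hm.2 hw, ih (n - m) (by omega) (by simp [hw, hy, hz])]
        simp

theorem map_forestGF {φ : MvPowerSeries σ ℚ →ₐ[ℚ] MvPowerSeries τ ℚ}
    (hφ : ∀ f, constantCoeff f = 0 → constantCoeff (φ f) = 0) {x y z w : MvPowerSeries σ ℚ}
    (t : MvPowerSeries σ ℚ) (hw : constantCoeff w = 0) (hx : constantCoeff x = 0)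
    (hy : constantCoeff y = 0) (hz : constantCoeff z = 0) (n : ℕ) :
    φ (forestGF x y z t n w) = forestGF (φ x) (φ y) (φ z) (φ t) n (φ w) := by
  induction n using Nat.strong_induction_on generalizing w with
  | _ n ih =>
    obtain rfl | hn := eq_or_ne n 0
    · simp [forestGF_zero]
    · have hC : φ (C (n : ℚ)⁻¹) = C (n : ℚ)⁻¹ := φ.commutes _
      rw [forestGF_of_ne_zero _ _ _ _ hn, forestGF_of_ne_zero _ _ _ _ hn, map_mul, hC, map_sum]
      congr 1
      refine Finset.sum_congr rfl fun k hk => ?_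
      rw [Finset.mem_Icc] at hk
      rw [map_mul, map_mul, map_pow, ih (n - k) (by omega) (by simp [hw, hz])]
      have := map_treeGF (φ := (φ : MvPowerSeries σ ℚ →+* MvPowerSeries τ ℚ)) hφ hw hx hy hz k
      simp only [RingHom.coe_coe] at this
      rw [this]
      simp

/-! ### Interrupted searches -/

/-- The seen proper descendants of `u`. -/
def State.desc (s : State n) (u : Fin n) : Finset (Fin n) :=
  Finset.univ.filter fun v => u ∈ (s.anc v).getD []

theorem State.mem_desc {s : State n} {u v : Fin n} : v ∈ s.desc u ↔ u ∈ (s.anc v).getD [] := by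
  simp [State.desc]

/-- The list `st` consists of a current vertex of a search and its ancestors up to the root, and the
list `as` tells for each of them how many vertices had been seen before it; `S` is the number of
vertices seen so far. -/
def State.IsStack (s : State n) (S : ℕ) : List (Fin n) → List ℕ → Prop
  | [], [] => True
  | u :: st, a :: as => s.anc u = some st ∧ u ∉ st ∧ (s.desc u).card + a + 1 = S ∧ s.IsStack S st as
  | _, _ => False

/-- The state `s` of a search, with the stack `st` of the vertices that are being explored; `S` is the
number of vertices seen so far, and `as` is as in `State.IsStack`. -/
structure State.Interrupted (s : State n) (S : ℕ) (st : List (Fin n)) (as : List ℕ) : Prop where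
  isStack : s.IsStack S st as
  card_unseen : S + s.unseen.card = n
  seen_of_mem : ∀ v a, s.anc v = some a → ∀ w ∈ a, s.anc w ≠ none

namespace State

variable {s : State n} {S a : ℕ} {u v : Fin n} {st : List (Fin n)} {as : List ℕ}

theorem IsStack.length_eq (h : s.IsStack S st as) : st.length = as.length := by
  induction st generalizing as with
  | nil => cases as with
    | nil => rfl
    | cons => exact h.elim
  | cons u st ih => cases as with
    | nil => exact h.elim
    | cons a as => simp [ih h.2.2.2]

theorem IsStack.nodup (h : s.IsStack S st as) : st.Nodup := by
  induction st generalizing as with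
  | nil => simp
  | cons u st ih => cases as with
    | nil => exact h.elim
    | cons a as => exact List.nodup_cons.2 ⟨h.2.1, ih h.2.2.2⟩

theorem IsStack.exists_anc_eq (h : s.IsStack S st as) (hu : u ∈ st) :
    ∃ b, s.anc u = some b ∧ ∀ w ∈ b, w ∈ st := by
  induction st generalizing as with
  | nil => simp at hu
  | cons u' st ih => cases as with
    | nil => exact h.elim
    | cons a as =>
      obtain rfl | hu := List.mem_cons.1 hu
      · exact ⟨st, h.1, fun w hw => List.mem_cons_of_mem _ hw⟩
      · obtain ⟨b, hb, hb'⟩ := ih h.2.2.2 hu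
        exact ⟨b, hb, fun w hw => List.mem_cons_of_mem _ (hb' w hw)⟩

theorem IsStack.anc_ne_none (h : s.IsStack S st as) (hu : u ∈ st) : s.anc u ≠ none := by
  obtain ⟨b, hb, -⟩ := h.exists_anc_eq hu
  simp [hb]

/-- A vertex that is discovered from the current vertex is put on top of the stack. -/
theorem Interrupted.discover (h : s.Interrupted S st as) (hv : s.anc v = none) :
    (s.discover v st).Interrupted (S + 1) (v :: st) (S :: as) := by
  have hanc : ∀ w, w ≠ v → (s.discover v st).anc w = s.anc w := fun w hw => by
    simp [State.discover, hw]
  have hvst : v ∉ st := fun hmem => h.isStack.anc_ne_none hmem hv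
  refine ⟨⟨by simp, hvst, ?_, ?_⟩, ?_, ?_⟩
  · have : (s.discover v st).desc v = ∅ := by
      refine Finset.eq_empty_of_forall_notMem fun w hw => ?_
      rw [mem_desc] at hw
      by_cases hwv : w = v
      · subst hwv
        exact hvst (by simpa using hw)
      · rw [hanc w hwv] at hw
        cases hs : s.anc w with
        | none => simp [hs] at hw
        | some b => exact h.seen_of_mem w b hs v (by simpa [hs] using hw) hv
    simp [this]
  · suffices ∀ st' as', (∀ w ∈ st', w ∈ st) → s.IsStack S st' as' →
        (s.discover v st).IsStack (S + 1) st' as' from this st as (fun _ hw => hw) h.isStack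
    intro st'
    induction st' with
    | nil => exact fun as' _ h' => by cases as' with
      | nil => trivial
      | cons => exact h'.elim
    | cons u st' ih =>
      intro as' hmem h'
      cases as' with
      | nil => exact h'.elim
      | cons a as' =>
        obtain ⟨h1, h2, h3, h4⟩ := h'
        have huv : u ≠ v := by
          rintro rfl; rw [hv] at h1; exact absurd h1 (by simp)
        refine ⟨by rw [hanc u huv, h1], h2, ?_, ih as' (fun w hw => hmem w (by simp [hw])) h4⟩
        have : (s.discover v st).desc u = insert v (s.desc u) := by
          ext w
          rw [Finset.mem_insert, mem_desc, mem_desc]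
          by_cases hwv : w = v
          · subst hwv
            simpa using hmem u (by simp)
          · rw [hanc w hwv]; simp [hwv]
        rw [this, Finset.card_insert_of_notMem (by rw [mem_desc, hv]; simp)]
        omega
  · have := card_unseen_discover hv st
    have := h.card_unseen
    omega
  · intro w b hw x hx
    have hle := le_discover hv st
    by_cases hwv : w = v
    · subst hwv
      obtain rfl : st = b := by simpa using hw
      exact hle.ne_none (h.isStack.anc_ne_none hx)
    · rw [hanc w hwv] at hw
      exact hle.ne_none (h.seen_of_mem w b hw x hx)

theorem Interrupted.record (h : s.Interrupted S st as) (u v : Fin n) :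
    (s.record u v).Interrupted S st as := by
  obtain ⟨h1, h2, h3⟩ := h
  refine ⟨?_, h2, h3⟩
  clear h2 h3
  induction st generalizing as with
  | nil => cases as with
    | nil => trivial
    | cons => exact h1.elim
  | cons w st ih => cases as with
    | nil => exact h1
    | cons a as => exact ⟨h1.1, h1.2.1, h1.2.2.1, ih h1.2.2.2⟩

theorem Interrupted.pop (h : s.Interrupted S (u :: st) (a :: as)) : s.Interrupted S st as :=
  ⟨h.isStack.2.2.2, h.card_unseen, h.seen_of_mem⟩

theorem interrupted_init :
    (⟨fun _ => none, fun _ => 0⟩ : State n).Interrupted 0 [] [] :=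
  ⟨trivial, by simp [State.unseen], by simp⟩

/-- The number of possible arcs of each type from the current vertex to a seen vertex. -/
theorem Interrupted.sum_arcType {R : Type*} [CommRing R] (h : s.Interrupted S (u :: st) (a :: as))
    (f : ArcType → R) :
    ∑ v ∈ s.unseenᶜ, f (s.arcType u v) =
      f .loop + (as.length : R) * f .back + ((a : R) - (as.length : R)) * f .cross +
        (((S - a : ℕ) : R) - 1) * f .forward := by
  obtain ⟨h1, h2, h3, h4⟩ := h.isStack
  have hu : u ∈ s.unseenᶜ := by simp [h1]
  have hst : st.toFinset ⊆ s.unseenᶜ := fun w hw => by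
    simpa using h4.anc_ne_none (by simpa using hw)
  have hdesc : s.desc u ⊆ s.unseenᶜ := fun w hw => by
    rw [mem_desc] at hw
    simp only [Finset.mem_compl, mem_unseen]
    intro hw'
    simp [hw'] at hw
  -- A seen vertex is of at most one of the three kinds below; otherwise the arc is a cross arc.
  have key : ∀ v ∈ s.unseenᶜ, f (s.arcType u v) = f .cross +
      (if v = u then f .loop - f .cross else 0) +
      (if v ∈ st.toFinset then f .back - f .cross else 0) +
      (if v ∈ s.desc u then f .forward - f .cross else 0) := by
    intro v hv
    simp only [Finset.mem_compl, mem_unseen] at hv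
    obtain ⟨b, hb⟩ := Option.ne_none_iff_exists'.1 hv
    rw [arcType]
    simp only [mem_desc, hb, h1, Option.getD_some, List.mem_toFinset]
    by_cases hvu : v = u
    · subst hvu
      obtain rfl : st = b := by simpa [h1] using hb
      simp [h2]
    · by_cases hvst : v ∈ st
      · obtain ⟨b', hb', hb''⟩ := h4.exists_anc_eq hvst
        obtain rfl : b = b' := by simpa [hb] using hb'
        have : u ∉ b := fun hub => h2 (hb'' u hub)
        simp [hvu, hvst, this]
      · by_cases hub : u ∈ b <;> simp [hvu, hvst, hub]
  rw [Finset.sum_congr rfl key]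
  simp only [Finset.sum_add_distrib, Finset.sum_ite_mem, Finset.sum_ite_eq', hu, if_true,
    Finset.sum_const, Finset.inter_eq_right.2 hst, Finset.inter_eq_right.2 hdesc, nsmul_eq_mul,
    List.toFinset_card_of_nodup h4.nodup, h4.length_eq, Finset.card_compl, Fintype.card_fin]
  have h5 : n - s.unseen.card = S := by have := h.card_unseen; omega
  have h6 : S - a = (s.desc u).card + 1 := by omega
  rw [h5, h6, ← h3]
  push_cast
  ring

theorem Interrupted.getD_anc (h : s.Interrupted S (u :: st) (a :: as)) :
    (s.anc u).getD [] = st := by rw [h.isStack.1]; rfl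

/-- The vertices that still have arcs to be explored. -/
def active (s : State n) (st : List (Fin n)) : Finset (Fin n) := s.unseen ∪ st.toFinset

theorem Interrupted.active_pop (h : s.Interrupted S (u :: st) (a :: as)) :
    s.active st = (s.active (u :: st)).erase u := by
  obtain ⟨h1, h2, -⟩ := h.isStack
  ext w
  simp only [active, Finset.mem_union, mem_unseen, List.mem_toFinset, Finset.mem_erase,
    List.mem_cons]
  by_cases hw : w = u
  · subst hw; simp [h1, h2]
  · simp [hw]

theorem active_discover (hv : s.anc v = none) (st : List (Fin n)) (b : List (Fin n)) :
    (s.discover v b).active (v :: st) = s.active st := by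
  ext w
  simp only [active, Finset.mem_union, unseen_discover, List.mem_toFinset, Finset.mem_erase,
    List.mem_cons, mem_unseen]
  by_cases hw : w = v
  · subst hw; simp [hv]
  · simp [hw]

theorem active_record (u v : Fin n) (st : List (Fin n)) :
    (s.record u v).active st = s.active st := rfl

end State

/-- The total number of arcs explored so far. -/
def State.total (s : State n) : ℕ :=
  s.count .loop + s.count .forward + s.count .back + s.count .cross + s.count .tree

theorem State.total_record (s : State n) (u v : Fin n) : (s.record u v).total = s.total + 1 := by
  simp only [State.total, State.record]
  cases s.arcType u v <;> simp <;> omega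

theorem sum_length_update {g : Arcs n} {u v : Fin n} {l : List (Fin n)} (h : g u = v :: l) :
    ∑ w, (g w).length = ∑ w, (Function.update g u l w).length + 1 := by
  rw [← Finset.add_sum_erase _ _ (Finset.mem_univ u), ← Finset.add_sum_erase (a := u)
    Finset.univ (fun w => (Function.update g u l w).length) (Finset.mem_univ u), h,
    Finset.sum_congr rfl fun w hw => by rw [← Function.update_of_ne (Finset.ne_of_mem_erase hw) l g]]
  simp
  omega

/-- Every arc is explored exactly once. -/
theorem total_finish {g : Arcs n} {s : State n} {S : ℕ} {st : List (Fin n)} {as : List ℕ}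
    (h : s.Interrupted S st as) (hg : ∀ v, v ∉ s.active st → g v = []) :
    (finish g st s).total = s.total + ∑ v, (g v).length := by
  -- A new vertex on the stack is paid for by the vertex no longer being unseen, hence the factor `2`;
  -- recording an arc shortens a list.
  obtain ⟨N, hN⟩ : ∃ N, N = 2 * ∑ v, (g v).length + 2 * s.unseen.card + st.length := ⟨_, rfl⟩
  induction N using Nat.strong_induction_on generalizing g s S st as with
  | _ N ih =>
    cases st with
    | nil =>
      by_cases hs : s.unseen = ∅
      · rw [finish_nil_of_unseen_eq_empty g hs, Finset.sum_eq_zero, add_zero]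
        intro v _
        rw [hg v (by simp [State.active, hs]), List.length_nil]
      · obtain ⟨r, hr, hfin⟩ := exists_finish_nil_eq hs
        obtain rfl : as = [] := by simpa using h.isStack.length_eq.symm
        have h1 := State.card_unseen_discover hr []
        rw [hfin, ih _ _ (h.discover hr) (by rwa [State.active_discover hr]) rfl]
        · rfl
        · simp only [List.length_nil, List.length_cons] at hN ⊢
          omega
    | cons u st =>
      cases as with
      | nil => exact absurd h.isStack id
      | cons a as =>
        have hst : ∀ w ∈ u :: st, s.anc w ≠ none := fun w hw => h.isStack.anc_ne_none hw
        cases hu : g u with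
        | nil =>
          rw [finish_cons_of_eq_nil hu]
          refine ih _ ?_ h.pop (fun v hv => ?_) rfl
          · simp only [List.length_cons] at hN; omega
          · rw [h.active_pop, Finset.mem_erase, not_and] at hv
            by_cases hvu : v = u
            · rw [hvu, hu]
            · exact hg v (hv hvu)
        | cons v l =>
          have h1 := sum_length_update hu
          have h2 : ∀ w, w ∉ s.active (u :: st) → Function.update g u l w = [] := fun w hw => by
            rw [Function.update_of_ne, hg w hw]
            rintro rfl
            exact hw (by simp [State.active])
          by_cases hv : s.anc v = none
          · have h3 := State.card_unseen_discover (s := s.record u v) hv (u :: st)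
            have h4 : (s.record u v).unseen.card = s.unseen.card := rfl
            have h5 := State.total_record s u v
            rw [finish_cons_of_unseen hst h.isStack.nodup hu hv, h.getD_anc,
              ih _ _ ((h.record u v).discover hv) (by
                rwa [State.active_discover (s := s.record u v) hv]) rfl]
            · change (s.record u v).total + _ = _
              omega
            · simp only [List.length_cons] at hN ⊢; omega
          · have h5 := State.total_record s u v
            rw [finish_cons_of_seen hst h.isStack.nodup hu hv, ih _ _ (h.record u v) h2 rfl]
            · omega
            · change 2 * _ + 2 * s.unseen.card + _ < _
              omega

/-! ### Generating functions of searches -/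

/-- The monomial that marks the arcs of type `k` by the variable `φ k`, as an exponent. -/
noncomputable def mark (φ : ArcType → σ) (c : ArcType → ℕ) : σ →₀ ℕ :=
  .single (φ .loop) (c .loop) + .single (φ .forward) (c .forward) + .single (φ .back) (c .back) +
    .single (φ .cross) (c .cross) + .single (φ .tree) (c .tree)

theorem mark_add (φ : ArcType → σ) (c c' : ArcType → ℕ) :
    mark φ (c + c') = mark φ c + mark φ c' := by
  simp only [mark, Pi.add_apply, Finsupp.single_add]
  abel

theorem mark_single (φ : ArcType → σ) (k : ArcType) :
    mark φ (Pi.single k 1) = .single (φ k) 1 := by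
  cases k <;> simp [mark]

theorem degree_mark (φ : ArcType → σ) (s : State n) : (mark φ s.count).degree = s.total := by
  simp [mark, State.total]

theorem State.record_eq_addCount (s : State n) (u v : Fin n) :
    s.record u v = s.addCount (Pi.single (s.arcType u v) 1) := by
  change State.mk _ _ = State.mk _ _
  congr 1
  ext k
  by_cases hk : k = s.arcType u v <;> simp [hk]

/-- The generating function of the lists of arcs from the vertices in `A`, where the arcs counted by
`f` are marked by the variables `φ k`. -/
noncomputable def arcsGF (φ : ArcType → σ) (A : Finset (Fin n)) (f : Arcs n → ArcType → ℕ) :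
    MvPowerSeries σ ℚ := fun m =>
  ({g : Arcs n | (∀ v, v ∉ A → g v = []) ∧ mark φ (f g) = m}.ncard : ℚ)

theorem coeff_arcsGF (φ : ArcType → σ) (A : Finset (Fin n)) (f : Arcs n → ArcType → ℕ)
    (m : σ →₀ ℕ) : coeff m (arcsGF φ A f) =
      ({g : Arcs n | (∀ v, v ∉ A → g v = []) ∧ mark φ (f g) = m}.ncard : ℚ) := rfl

theorem arcsGF_congr (φ : ArcType → σ) {A : Finset (Fin n)} {f f' : Arcs n → ArcType → ℕ}
    (h : ∀ g : Arcs n, (∀ v, v ∉ A → g v = []) → f g = f' g) : arcsGF φ A f = arcsGF φ A f' := by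
  ext m
  rw [coeff_arcsGF, coeff_arcsGF]
  congr 2
  ext g
  exact and_congr_right fun hg => by rw [h g hg]

/-- A shift of the counts multiplies the generating function by a monomial. -/
theorem arcsGF_add_const (φ : ArcType → σ) (A : Finset (Fin n)) (f : Arcs n → ArcType → ℕ)
    (c : ArcType → ℕ) :
    arcsGF φ A (fun g => f g + c) = monomial (mark φ c) 1 * arcsGF φ A f := by
  classical
  ext m
  rw [coeff_monomial_mul, coeff_arcsGF]
  split_ifs with h
  · rw [one_mul, coeff_arcsGF]
    congr 2
    ext g
    simp only [Set.mem_ofPred_eq, mark_add]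
    refine and_congr_right fun _ => ?_
    rw [eq_tsub_iff_add_eq_of_le h]
  · rw [Set.eq_empty_of_forall_notMem (s := {g : Arcs n | _})]
    · simp
    · rintro g ⟨-, rfl⟩
      exact h (by rw [mark_add]; exact le_add_self)

theorem arcsGF_empty (φ : ArcType → σ) (f : Arcs n → ArcType → ℕ) :
    arcsGF φ ∅ f = monomial (mark φ (f fun _ => [])) 1 := by
  classical
  ext m
  rw [coeff_monomial, coeff_arcsGF]
  have h1 : ∀ g : Arcs n, (∀ v, v ∉ (∅ : Finset (Fin n)) → g v = []) ↔ g = fun _ => [] :=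
    fun g => ⟨fun h => funext fun v => h v (by simp), fun h v _ => by rw [h]⟩
  simp only [h1]
  split_ifs with h
  · rw [show {g : Arcs n | g = (fun _ => []) ∧ mark φ (f g) = m} = {fun _ => []} by
      ext g
      simp only [Set.mem_ofPred_eq, Set.mem_singleton_iff, and_iff_left_iff_imp]
      rintro rfl; exact h.symm]
    simp
  · rw [show {g : Arcs n | g = (fun _ => []) ∧ mark φ (f g) = m} = ∅ by
      ext g
      simp only [Set.mem_ofPred_eq, Set.mem_empty_iff_false, iff_false, not_and]
      rintro rfl; exact fun h' => h h'.symm]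
    simp

/-- The list of arcs from `u` is empty or has a first arc. -/
theorem arcsGF_eq_erase_add (φ : ArcType → σ) {A : Finset (Fin n)} {u : Fin n} (hu : u ∈ A)
    {f : Arcs n → ArcType → ℕ}
    (hf : ∀ m, {g : Arcs n | (∀ v, v ∉ A → g v = []) ∧ mark φ (f g) = m}.Finite) :
    arcsGF φ A f = arcsGF φ (A.erase u) f +
      ∑ v, arcsGF φ A fun g => f (Function.update g u (v :: g u)) := by
  ext m
  rw [map_add, map_sum]
  simp only [coeff_arcsGF]
  set X := {g : Arcs n | (∀ v, v ∉ A → g v = []) ∧ mark φ (f g) = m} with hX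
  set Y := {g : Arcs n | (∀ v, v ∉ A.erase u → g v = []) ∧ mark φ (f g) = m} with hY
  let Z : Fin n → Set (Arcs n) := fun v => {g : Arcs n | (∀ v, v ∉ A → g v = []) ∧
    mark φ (f (Function.update g u (v :: g u))) = m}
  let e : Fin n → Arcs n → Arcs n := fun v g => Function.update g u (v :: g u)
  have he : ∀ v, Function.Injective (e v) := by
    intro v g g' h
    ext1 w
    have := congrFun h w
    by_cases hw : w = u
    · subst hw; simpa [e] using this
    · simpa [e, hw] using this
  have h1 : X = Y ∪ ⋃ v, e v '' Z v := by
    ext g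
    simp only [Set.mem_union, Set.mem_iUnion, Set.mem_image]
    constructor
    · rintro ⟨h1, h2⟩
      cases hgu : g u with
      | nil =>
        refine Or.inl ⟨fun v hv => ?_, h2⟩
        by_cases hvu : v = u
        · rw [hvu, hgu]
        · exact h1 v fun hvA => hv (Finset.mem_erase.2 ⟨hvu, hvA⟩)
      | cons v l =>
        have h3 : e v (Function.update g u l) = g := by
          simp [e, ← hgu]
        refine Or.inr ⟨v, Function.update g u l, ⟨fun w hw => ?_, ?_⟩, h3⟩
        · rw [Function.update_of_ne (by rintro rfl; exact hw hu), h1 w hw]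
        · change mark φ (f (e v (Function.update g u l))) = m
          rw [h3, h2]
    · rintro (⟨h1, h2⟩ | ⟨v, g, ⟨h1, h2⟩, rfl⟩)
      · exact ⟨fun v hv => h1 v fun hv' => hv (Finset.mem_of_mem_erase hv'), h2⟩
      · refine ⟨fun w hw => ?_, h2⟩
        simp only [e]
        rw [Function.update_of_ne (by rintro rfl; exact hw hu), h1 w hw]
  have hfin : X.Finite := hf m
  have hYfin : Y.Finite := hfin.subset (h1 ▸ Set.subset_union_left)
  have hUfin : (⋃ v, e v '' Z v).Finite := hfin.subset (h1 ▸ Set.subset_union_right)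
  have hdisj : Disjoint Y (⋃ v, e v '' Z v) := by
    rw [Set.disjoint_left]
    intro g hg hg'
    obtain ⟨v, g', -, rfl⟩ := Set.mem_iUnion.1 hg'
    have := hg.1 u (by simp)
    simp [e] at this
  have hdisj' : Pairwise (Function.onFun Disjoint fun v => e v '' Z v) := by
    intro v w hvw
    rw [Function.onFun, Set.disjoint_left]
    rintro _ ⟨g, -, rfl⟩ ⟨g', -, h⟩
    have := congrFun h u
    simp only [e, Function.update_self, List.cons.injEq] at this
    exact hvw this.1.symm
  rw [h1, Set.ncard_union_eq hdisj hYfin hUfin, Set.ncard_iUnion_of_finite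
    (fun v => hUfin.subset (Set.subset_iUnion _ v)) hdisj', finsum_eq_sum_of_fintype]
  simp only [fun v => Set.ncard_image_of_injective (Z v) (he v)]
  push_cast
  rfl

theorem finite_setOf_sum_length_eq (n N : ℕ) :
    {g : Arcs n | ∑ v, (g v).length = N}.Finite := by
  refine (Set.Finite.pi fun _ : Fin n => List.finite_length_le (Fin n) N).subset fun g hg v _ => ?_
  rw [Set.mem_ofPred_eq] at hg ⊢
  rw [← hg]
  exact Finset.single_le_sum (f := fun v => (g v).length) (fun _ _ => Nat.zero_le _)
    (Finset.mem_univ v)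

theorem finite_setOf_mark_finish (φ : ArcType → σ) {s : State n} {S : ℕ} {st : List (Fin n)}
    {as : List ℕ} (h : s.Interrupted S st as) (m : σ →₀ ℕ) :
    {g : Arcs n | (∀ v, v ∉ s.active st → g v = []) ∧
      mark φ (finish g st s).count = m}.Finite := by
  refine (finite_setOf_sum_length_eq n (m.degree - s.total)).subset ?_
  rintro g ⟨hg, rfl⟩
  rw [Set.mem_ofPred_eq, degree_mark, total_finish h hg]
  omega

/-- The generating function of the ways to finish an interrupted search: it satisfies the same
recursion as `stackGF`, which determines it by induction on the numbers of unseen vertices and of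
vertices on the stack. -/
theorem arcsGF_finish (φ : ArcType → σ) {s : State n} {S : ℕ} {st : List (Fin n)}
    {as : List ℕ} (h : s.Interrupted S st as) :
    arcsGF φ (s.active st) (fun g => (finish g st s).count) =
      monomial (mark φ s.count) 1 * (((n - S).factorial : MvPowerSeries σ ℚ) *
        stackGF (X (φ .loop)) (X (φ .forward)) (X (φ .back)) (X (φ .cross)) (X (φ .tree)) n
          as S) := by
  obtain ⟨N, hN⟩ : ∃ N, N = 2 * s.unseen.card + st.length := ⟨_, rfl⟩
  induction N using Nat.strong_induction_on generalizing s S st as with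
  | _ N ih =>
    have hS := h.card_unseen
    cases st with
    | nil =>
      obtain rfl : as = [] := by simpa using h.isStack.length_eq.symm
      by_cases hs : s.unseen = ∅
      · have hSn : S = n := by simpa [hs] using hS
        subst hSn
        rw [show s.active [] = ∅ by simp [State.active, hs], arcsGF_empty,
          finish_nil_of_unseen_eq_empty _ hs, stackGF, Nat.sub_self, forestGF_zero]
        simp
      · obtain ⟨r, hr, hfin⟩ := exists_finish_nil_eq hs
        have h1 := State.card_unseen_discover hr []
        have h2 := Finset.card_pos.2 (Finset.nonempty_iff_ne_empty.2 hs)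
        simp only [hfin, ← State.active_discover hr [] []]
        rw [ih _ _ (h.discover hr) rfl, ← natCast_mul_stackGF_nil _ _ _ _ _ (by omega),
          ← mul_assoc ((n - (S + 1)).factorial : MvPowerSeries σ ℚ), ← Nat.cast_mul,
          show n - S = n - (S + 1) + 1 by omega, Nat.factorial_succ, mul_comm (_ + 1)]
        · rfl
        · simp only [List.length_nil, List.length_cons] at hN ⊢
          omega
    | cons u st =>
      cases as with
      | nil => exact absurd h.isStack id
      | cons a as =>
        have hst : ∀ w ∈ u :: st, s.anc w ≠ none := fun w hw => h.isStack.anc_ne_none hw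
        have haS : a < S := by have := h.isStack.2.2.1; omega
        set W := arcsGF φ (s.active (u :: st)) fun g => (finish g (u :: st) s).count with hW
        set U : List ℕ → ℕ → MvPowerSeries σ ℚ := stackGF (X (φ .loop)) (X (φ .forward))
          (X (φ .back)) (X (φ .cross)) (X (φ .tree)) n with hUdef
        have hpop : arcsGF φ ((s.active (u :: st)).erase u)
            (fun g => (finish g (u :: st) s).count) =
            monomial (mark φ s.count) 1 * (((n - S).factorial : MvPowerSeries σ ℚ) * U as S) := by
          rw [← h.active_pop, ← ih _ _ h.pop rfl]
          · refine arcsGF_congr φ fun g hg => ?_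
            rw [finish_cons_of_eq_nil (hg u (by rw [h.active_pop]; simp))]
          · simp only [List.length_cons] at hN; omega
        have hseen : ∀ v ∈ s.unseenᶜ, arcsGF φ (s.active (u :: st))
            (fun g => (finish (Function.update g u (v :: g u)) (u :: st) s).count) =
            X (φ (s.arcType u v)) * W := by
          intro v hv
          rw [X, ← mark_single, hW, ← arcsGF_add_const]
          refine arcsGF_congr φ fun g _ => ?_
          rw [finish_cons_of_seen (v := v) (l := g u) hst h.isStack.nodup (by simp)
            (by simpa using hv),
            Function.update_idem, Function.update_eq_self, State.record_eq_addCount,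
            finish_addCount]
          rfl
        have hunseen : ∀ v ∈ s.unseen, arcsGF φ (s.active (u :: st))
            (fun g => (finish (Function.update g u (v :: g u)) (u :: st) s).count) =
            monomial (mark φ s.count) 1 * (X (φ .tree) *
              (((n - (S + 1)).factorial : MvPowerSeries σ ℚ) * U (S :: a :: as) (S + 1))) := by
          intro v hv
          have hv' : s.anc v = none := by simpa using hv
          have h1 := State.card_unseen_discover (s := s.record u v) hv' (u :: st)
          have h2 : (s.record u v).unseen.card = s.unseen.card := rfl
          have h3 : s.arcType u v = .tree := by simp [State.arcType, hv']
          have h4 : ((s.record u v).discover v (u :: st)).count =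
              s.count + Pi.single ArcType.tree 1 := by
            rw [State.record_eq_addCount, h3]; rfl
          have := ih _ (by simp only [List.length_cons] at hN ⊢; omega)
            ((h.record u v).discover hv') rfl
          rw [State.active_discover (s := s.record u v) hv', State.active_record, h4, mark_add,
            mark_single, ← mul_one (1 : ℚ), ← monomial_mul_monomial, mul_assoc] at this
          rw [X, ← this]
          refine arcsGF_congr φ fun g _ => ?_
          rw [finish_cons_of_unseen (v := v) (l := g u) hst h.isStack.nodup (by simp) hv',
            Function.update_idem, Function.update_eq_self, h.getD_anc]
        -- If no vertex is unseen, then the left side is `0`, and so is `U (S :: a :: as) (S + 1)`.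
        have hfact : (s.unseen.card : MvPowerSeries σ ℚ) *
            (((n - (S + 1)).factorial : MvPowerSeries σ ℚ) * U (S :: a :: as) (S + 1)) =
            ((n - S).factorial : MvPowerSeries σ ℚ) * U (S :: a :: as) (S + 1) := by
          obtain hlt | heq := Nat.lt_or_ge S n
          · rw [← mul_assoc, ← Nat.cast_mul, show s.unseen.card = n - (S + 1) + 1 by omega,
              ← Nat.factorial_succ, show n - (S + 1) + 1 = n - S by omega]
          · have : U (S :: a :: as) (S + 1) = 0 := by
              rw [hUdef, stackGF, Finset.Icc_eq_empty (by omega), Finset.sum_empty]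
            simp [this]
        -- The arcs to seen vertices lead back to the same `W`, so that the step is an equation for `W`.
        have hstep : W = monomial (mark φ s.count) 1 *
              (((n - S).factorial : MvPowerSeries σ ℚ) * U as S) +
            (monomial (mark φ s.count) 1 * (X (φ .tree) *
              (((n - S).factorial : MvPowerSeries σ ℚ) * U (S :: a :: as) (S + 1))) +
            (∑ v ∈ s.unseenᶜ, X (φ (s.arcType u v))) * W) := by
          conv_lhs => rw [hW, arcsGF_eq_erase_add φ (u := u) (by simp [State.active])
            (finite_setOf_mark_finish φ h), hpop, ← Finset.sum_add_sum_compl s.unseen,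
            Finset.sum_congr rfl hunseen, Finset.sum_congr rfl hseen, Finset.sum_const,
            nsmul_eq_mul, ← Finset.sum_mul]
          rw [← hfact]
          ring
        rw [h.sum_arcType fun k => (X (φ k) : MvPowerSeries σ ℚ)] at hstep
        have hU := loop_factor_mul_stackGF_cons (w := X (φ .loop)) (x := X (φ .forward))
          (y := X (φ .back)) (z := X (φ .cross)) (X (φ .tree)) (by simp) (by simp) (by simp)
          (by simp) as haS (by omega : S ≤ n)
        refine (MvPowerSeries.isUnit_iff_constantCoeff.2 ?_ : IsUnit
          (1 - (X (φ .loop) + (as.length : MvPowerSeries σ ℚ) * X (φ .back) +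
            ((a : MvPowerSeries σ ℚ) - (as.length : MvPowerSeries σ ℚ)) * X (φ .cross)) -
            (((S - a : ℕ) : MvPowerSeries σ ℚ) - 1) * X (φ .forward))).mul_left_cancel ?_
        · simp
        · linear_combination hstep -
            monomial (mark φ s.count) 1 * ((n - S).factorial : MvPowerSeries σ ℚ) * hU

/-- The generating function of the depth-first searches on `n` vertices. -/
theorem arcsGF_search (φ : ArcType → σ) (n : ℕ) :
    arcsGF φ Finset.univ (fun g : Arcs n => (search g).count) =
      (n.factorial : MvPowerSeries σ ℚ) *
        forestGF (X (φ .forward)) (X (φ .back)) (X (φ .cross)) (X (φ .tree)) n (X (φ .loop)) := by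
  have h := arcsGF_finish φ (State.interrupted_init (n := n))
  rw [show State.active (⟨fun _ => none, fun _ => 0⟩ : State n) [] = Finset.univ by
    ext; simp [State.active]] at h
  simpa [mark, stackGF, search_eq_finish] using h

theorem total_search (g : Arcs n) : (search g).total = ∑ v, (g v).length := by
  rw [search_eq_finish, total_finish State.interrupted_init fun v hv =>
    absurd (by simp [State.active]) hv]
  simp [State.total]

/-! ### The power series `GX n` and `GY n` -/

theorem subst_treeGF [Finite σ] {b : σ → MvPowerSeries τ ℚ} (hb : ∀ i, constantCoeff (b i) = 0)
    {x y z w : MvPowerSeries σ ℚ} (hw : constantCoeff w = 0) (hx : constantCoeff x = 0)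
    (hy : constantCoeff y = 0) (hz : constantCoeff z = 0) (n : ℕ) :
    (treeGF x y z n w).subst b =
      treeGF (x.subst b) (y.subst b) (z.subst b) n (w.subst b) := by
  have hb' : HasSubst b := hasSubst_of_constantCoeff_zero hb
  have := map_treeGF (φ := (substAlgHom (R := ℚ) (S := ℚ) hb').toRingHom)
    (fun f hf => by simpa using constantCoeff_subst_eq_zero hb' hb hf) hw hx hy hz n
  simpa using this

theorem subst_forestGF [Finite σ] {b : σ → MvPowerSeries τ ℚ} (hb : ∀ i, constantCoeff (b i) = 0)
    {x y z w : MvPowerSeries σ ℚ} (t : MvPowerSeries σ ℚ) (hw : constantCoeff w = 0)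
    (hx : constantCoeff x = 0) (hy : constantCoeff y = 0) (hz : constantCoeff z = 0) (n : ℕ) :
    (forestGF x y z t n w).subst b =
      forestGF (x.subst b) (y.subst b) (z.subst b) (t.subst b) n (w.subst b) := by
  have hb' : HasSubst b := hasSubst_of_constantCoeff_zero hb
  have := map_forestGF (φ := substAlgHom (R := ℚ) (S := ℚ) hb')
    (fun f hf => by simpa using constantCoeff_subst_eq_zero hb' hb hf) t hw hx hy hz n
  simpa using this

/-- In `GX n`, both back and cross arcs are marked by the third variable. -/
theorem GX_eq_treeGF {n : ℕ} (hn : 1 ≤ n) : GX n = treeGF (X 1) (X 2) (X 2) n (X 0) := by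
  induction n using Nat.strong_induction_on with
  | _ n ih =>
    rw [GX]
    split_ifs with h
    · rw [h, treeGF_one]
    · rw [treeGF_of_ne_one _ _ _ h]
      congr 1
      rw [Finset.sum_coe_sort (Finset.Ico 1 n) fun m : ℕ => GX m * (GX (n - m)).subst
        ![X 0 + (m : MvPowerSeries (Fin 3) ℚ) * X 2, X 1, X 2]]
      refine Finset.sum_congr rfl fun m hm => ?_
      rw [Finset.mem_Ico] at hm
      have hb : ∀ i, constantCoeff ((![X 0 + (m : MvPowerSeries (Fin 3) ℚ) * X 2, X 1, X 2] :
          Fin 3 → MvPowerSeries (Fin 3) ℚ) i) = 0 := by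
        intro i; fin_cases i <;> simp
      rw [ih m hm.2 hm.1, ih (n - m) (by omega) (by omega),
        subst_treeGF hb (by simp) (by simp) (by simp) (by simp)]
      simp only [subst_X (hasSubst_of_constantCoeff_zero hb)]
      simp only [Matrix.cons_val]
      congr 2
      ring

/-- In `GY n`, both forward and cross arcs are marked by the third variable. -/
theorem GY_eq_treeGF {n : ℕ} (hn : 1 ≤ n) : GY n = treeGF (X 2) (X 1) (X 2) n (X 0) := by
  induction n using Nat.strong_induction_on with
  | _ n ih =>
    rw [GY]
    split_ifs with h
    · rw [h, treeGF_one]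
    · rw [treeGF_of_ne_one _ _ _ h]
      congr 1
      rw [Finset.sum_coe_sort (Finset.Ico 1 n) fun m : ℕ => GY m * (GY (n - m)).subst
        ![X 0 + X 1 + ((m : MvPowerSeries (Fin 3) ℚ) - 1) * X 2, X 1, X 2]]
      refine Finset.sum_congr rfl fun m hm => ?_
      rw [Finset.mem_Ico] at hm
      have hb : ∀ i, constantCoeff ((![X 0 + X 1 + ((m : MvPowerSeries (Fin 3) ℚ) - 1) * X 2, X 1,
          X 2] : Fin 3 → MvPowerSeries (Fin 3) ℚ) i) = 0 := by
        intro i; fin_cases i <;> simp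
      rw [ih m hm.2 hm.1, ih (n - m) (by omega) (by omega),
        subst_treeGF hb (by simp) (by simp) (by simp) (by simp)]
      simp only [subst_X (hasSubst_of_constantCoeff_zero hb)]
      simp only [Matrix.cons_val]

theorem treeGF_eq_of_GX_eq_GY {n : ℕ} (hn : 1 ≤ n) (h : GX n = GY n) {x z w : MvPowerSeries τ ℚ}
    (hw : constantCoeff w = 0) (hx : constantCoeff x = 0) (hz : constantCoeff z = 0) :
    treeGF x z z n w = treeGF z x z n w := by
  have hb : ∀ i, constantCoeff ((![w, x, z] : Fin 3 → MvPowerSeries τ ℚ) i) = 0 := by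
    intro i; fin_cases i <;> simp [hw, hx, hz]
  have h' := congrArg (subst ![w, x, z]) h
  rw [GX_eq_treeGF hn, GY_eq_treeGF hn, subst_treeGF hb (by simp) (by simp) (by simp) (by simp),
    subst_treeGF hb (by simp) (by simp) (by simp) (by simp)] at h'
  simpa [subst_X (hasSubst_of_constantCoeff_zero hb)] using h'

theorem forestGF_eq_of_GX_eq_GY {n : ℕ} (h : ∀ k, 1 ≤ k → k ≤ n → GX k = GY k)
    {x z w : MvPowerSeries τ ℚ} (t : MvPowerSeries τ ℚ)
    (hw : constantCoeff w = 0) (hx : constantCoeff x = 0) (hz : constantCoeff z = 0) :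
    forestGF x z z t n w = forestGF z x z t n w := by
  induction n using Nat.strong_induction_on generalizing w with
  | _ n ih =>
    obtain rfl | hn := eq_or_ne n 0
    · rw [forestGF_zero, forestGF_zero]
    · rw [forestGF_of_ne_zero _ _ _ _ hn, forestGF_of_ne_zero _ _ _ _ hn]
      congr 1
      refine Finset.sum_congr rfl fun k hk => ?_
      rw [Finset.mem_Icc] at hk
      rw [treeGF_eq_of_GX_eq_GY hk.1 (h k hk.1 hk.2) hw hx hz,
        ih (n - k) (by omega) (fun j hj hj' => h j hj (by omega)) (by simp [hw, hz])]

/-- The forests that consist of a single tree determine the generating function of the trees, once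
the generating functions of the smaller trees are known. -/
theorem treeGF_eq_of_forestGF_eq {n : ℕ} (hn : 1 ≤ n) (h : ∀ k, 1 ≤ k → k < n → GX k = GY k)
    {x z w t : MvPowerSeries τ ℚ}
    (hw : constantCoeff w = 0) (hx : constantCoeff x = 0) (hz : constantCoeff z = 0) (ht : t ≠ 0)
    (hF : forestGF x z z t n w = forestGF z x z t n w) :
    treeGF x z z n w = treeGF z x z n w := by
  have h1 := natCast_mul_forestGF x z z t (show n ≠ 0 by omega) w
  rw [hF, natCast_mul_forestGF z x z t (show n ≠ 0 by omega) w, ← Finset.sum_erase_add _ _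
    (Finset.right_mem_Icc.2 hn), ← Finset.sum_erase_add _ _ (Finset.right_mem_Icc.2 hn),
    Finset.sum_congr rfl fun k hk => ?_, add_right_inj, Nat.sub_self, forestGF_zero,
    forestGF_zero, mul_one, mul_one] at h1
  · exact (mul_left_cancel₀ (pow_ne_zero _ ht) h1).symm
  · rw [Finset.mem_erase, Finset.mem_Icc] at hk
    rw [treeGF_eq_of_GX_eq_GY hk.2.1 (h k hk.2.1 (by omega)) hw hx hz,
      forestGF_eq_of_GX_eq_GY (n := n - k) (fun j hj hj' => h j hj (by omega)) t
        (by simp [hw, hz]) hx hz]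

theorem forall_forestGF_eq_iff :
    (∀ n, 1 ≤ n → forestGF (X 1) (X 2) (X 2) (X 3) n (X 0 : MvPowerSeries (Fin 4) ℚ) =
      forestGF (X 2) (X 1) (X 2) (X 3) n (X 0)) ↔ ∀ n, 1 ≤ n → GX n = GY n := by
  refine ⟨fun h n hn => ?_, fun h n _ => forestGF_eq_of_GX_eq_GY (fun k hk _ => h k hk) _
    (by simp) (by simp) (by simp)⟩
  induction n using Nat.strong_induction_on with
  | _ n ih =>
    have h1 := treeGF_eq_of_forestGF_eq hn (fun k hk hk' => ih k hk' hk) (by simp) (by simp)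
      (by simp) (fun h3 => by simpa using congrArg (coeff (Finsupp.single 3 1)) h3) (h n hn)
    -- The identity is free of the variable `t`, which may be set to `0`.
    have hb : ∀ i, constantCoeff ((![X 0, X 1, X 2, 0] :
        Fin 4 → MvPowerSeries (Fin 3) ℚ) i) = 0 := by
      intro i; fin_cases i <;> simp
    have h2 := congrArg (subst (![X 0, X 1, X 2, 0] : Fin 4 → MvPowerSeries (Fin 3) ℚ)) h1
    rw [subst_treeGF hb (by simp) (by simp) (by simp) (by simp),
      subst_treeGF hb (by simp) (by simp) (by simp) (by simp)] at h2
    simp only [subst_X (hasSubst_of_constantCoeff_zero hb)] at h2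
    rw [GX_eq_treeGF hn, GY_eq_treeGF hn]
    simpa using h2

/-! ### The generating function of all searches -/

/-- The variables `w, x, y, z, t` that mark the loops and the forward, back, cross and tree arcs. -/
def markW : ArcType → Fin 5
  | .loop => 0 | .forward => 1 | .back => 2 | .cross => 3 | .tree => 4

/-- The variables `w, x, z, z, t` that mark the loops and the forward, back, cross and tree arcs. -/
def markX : ArcType → Fin 4
  | .loop => 0 | .forward => 1 | .back => 2 | .cross => 2 | .tree => 3

/-- The variables `w, z, x, z, t` that mark the loops and the forward, back, cross and tree arcs. -/
def markY : ArcType → Fin 4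
  | .loop => 0 | .forward => 2 | .back => 1 | .cross => 2 | .tree => 3

theorem mark_markW_eq_iff (c : ArcType → ℕ) (m : Fin 5 →₀ ℕ) : mark markW c = m ↔
    c .loop = m 0 ∧ c .forward = m 1 ∧ c .back = m 2 ∧ c .cross = m 3 ∧ c .tree = m 4 := by
  rw [Finsupp.ext_iff]
  simp [Fin.forall_fin_succ, mark, markW, Finsupp.single_apply]

theorem mark_markX_eq_iff (c : ArcType → ℕ) (m : Fin 4 →₀ ℕ) : mark markX c = m ↔
    c .loop = m 0 ∧ c .forward = m 1 ∧ c .back + c .cross = m 2 ∧ c .tree = m 3 := by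
  rw [Finsupp.ext_iff]
  simp [Fin.forall_fin_succ, mark, markX, Finsupp.single_apply]

theorem mark_markY_eq_iff (c : ArcType → ℕ) (m : Fin 4 →₀ ℕ) : mark markY c = m ↔
    c .loop = m 0 ∧ c .back = m 1 ∧ c .forward + c .cross = m 2 ∧ c .tree = m 3 := by
  rw [Finsupp.ext_iff]
  simp [Fin.forall_fin_succ, mark, markY, Finsupp.single_apply]

theorem genF_eq (n : ℕ) : genF n = (n.factorial : MvPowerSeries (Fin 5) ℚ) *
    forestGF (X 1) (X 2) (X 3) (X 4) n (X 0) := by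
  refine Eq.trans ?_ (arcsGF_search markW n)
  funext m
  simp only [arcsGF, genF, mark_markW_eq_iff]
  simp [numL, numF, numB, numC, numT]

theorem subst_genF (n : ℕ) {b : Fin 5 → MvPowerSeries τ ℚ} (hb : ∀ i, constantCoeff (b i) = 0) :
    (genF n).subst b = (n.factorial : MvPowerSeries τ ℚ) *
      forestGF (b 1) (b 2) (b 3) (b 4) n (b 0) := by
  have hb' : HasSubst b := hasSubst_of_constantCoeff_zero hb
  have hn : (n.factorial : MvPowerSeries (Fin 5) ℚ).subst b = (n.factorial : MvPowerSeries τ ℚ) := by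
    rw [← substAlgHom_apply hb', map_natCast]
  rw [genF_eq, subst_mul hb', hn, subst_forestGF hb _ (by simp) (by simp) (by simp) (by simp)]
  simp only [subst_X hb']

theorem factorial_mul_inj (n : ℕ) {f g : MvPowerSeries τ ℚ} :
    (n.factorial : MvPowerSeries τ ℚ) * f = (n.factorial : MvPowerSeries τ ℚ) * g ↔ f = g := by
  refine mul_right_inj' fun h => ?_
  have := congrArg constantCoeff h
  simp [Nat.factorial_ne_zero] at this

theorem subst_genF_eq_iff (n : ℕ) :
    (genF n).subst (![X 0, X 1, X 2, X 2, X 3] : Fin 5 → MvPowerSeries (Fin 4) ℚ) =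
        (genF n).subst (![X 0, X 2, X 1, X 2, X 3] : Fin 5 → MvPowerSeries (Fin 4) ℚ) ↔
      forestGF (X 1) (X 2) (X 2) (X 3) n (X 0 : MvPowerSeries (Fin 4) ℚ) =
        forestGF (X 2) (X 1) (X 2) (X 3) n (X 0) := by
  rw [subst_genF, subst_genF, factorial_mul_inj]
  · rfl
  · intro i; fin_cases i <;> simp
  · intro i; fin_cases i <;> simp

/-- Both sides of the identity for forests count the searches according to the numbers of arcs. -/
theorem forestGF_eq_iff_ncard_eq (n : ℕ) :
    forestGF (X 1) (X 2) (X 2) (X 3) n (X 0 : MvPowerSeries (Fin 4) ℚ) =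
        forestGF (X 2) (X 1) (X 2) (X 3) n (X 0) ↔
      ∀ q : ℕ × ℕ × ℕ × ℕ,
        {g : Arcs n | (numL g, numF g, numB g + numC g, numT g) = q}.ncard =
          {g : Arcs n | (numL g, numB g, numF g + numC g, numT g) = q}.ncard := by
  have hX := arcsGF_search markX n
  have hY := arcsGF_search markY n
  simp only [markX] at hX
  simp only [markY] at hY
  rw [← factorial_mul_inj n, ← hX, ← hY, MvPowerSeries.ext_iff]
  simp only [coeff_arcsGF, mark_markX_eq_iff, mark_markY_eq_iff, Nat.cast_inj]
  simp only [Finset.mem_univ, not_true_eq_false, false_imp_iff, implies_true, true_and,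
    ← numL.eq_def, ← numF.eq_def, ← numB.eq_def, ← numC.eq_def, ← numT.eq_def]
  constructor
  · rintro h ⟨l, f, c, t⟩
    simpa using h (Finsupp.equivFunOnFinite.symm ![l, f, c, t])
  · intro h m
    simpa using h (m 0, m 1, m 2, m 3)

/-! ### The random digraph -/

instance : DiscreteMeasurableSpace (List (Fin n)) := ⟨fun _ => trivial⟩

theorem map_ofFn_uniformOn_singleton (hn : 1 ≤ n) (k : ℕ) (l : List (Fin n)) :
    ((Measure.pi fun _ : Fin k => uniformOn (Set.univ : Set (Fin n))).map List.ofFn) {l} =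
      if k = l.length then ((n : ENNReal)⁻¹) ^ l.length else 0 := by
  have : NeZero n := ⟨Nat.one_le_iff_ne_zero.1 hn⟩
  have := isProbabilityMeasure_uniformOn (Set.finite_univ (α := Fin n)) Set.univ_nonempty
  rw [Measure.map_apply (Measurable.of_discrete) (MeasurableSet.of_discrete)]
  split_ifs with h
  · subst h
    have : List.ofFn ⁻¹' {l} = {l.get} := by
      ext f
      simp only [Set.mem_preimage, Set.mem_singleton_iff]
      constructor
      · intro h
        apply List.ofFn_injective
        rw [h, List.ofFn_get]
      · rintro rfl
        exact List.ofFn_get l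
    rw [this, Measure.pi_singleton]
    simp [uniformOn_univ]
  · have : List.ofFn ⁻¹' {l} = (∅ : Set (Fin k → Fin n)) := by
      refine Set.eq_empty_of_forall_notMem fun f hf => h ?_
      rw [← Set.mem_singleton_iff.1 hf, List.length_ofFn]
    rw [this, measure_empty]

theorem isProbabilityMeasure_map_ofFn (hn : 1 ≤ n) (k : ℕ) : IsProbabilityMeasure
    ((Measure.pi fun _ : Fin k => uniformOn (Set.univ : Set (Fin n))).map List.ofFn) := by
  have : NeZero n := ⟨Nat.one_le_iff_ne_zero.1 hn⟩
  have := isProbabilityMeasure_uniformOn (Set.finite_univ (α := Fin n)) Set.univ_nonempty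
  exact Measure.isProbabilityMeasure_map Measurable.of_discrete.aemeasurable

theorem isProbabilityMeasure_outLaw (hn : 1 ≤ n) (p : unitInterval) :
    IsProbabilityMeasure (outLaw n p) :=
  isProbabilityMeasure_bind Measurable.of_discrete.aemeasurable
    (Filter.Eventually.of_forall fun k => isProbabilityMeasure_map_ofFn hn k)

theorem outLaw_singleton (hn : 1 ≤ n) {p : unitInterval} (hp : p < 1) (l : List (Fin n)) :
    outLaw n p {l} =
      ENNReal.ofReal (1 - p) * (ENNReal.ofReal p * (n : ENNReal)⁻¹) ^ l.length := by
  have hσ : unitInterval.symm p ≠ 0 := by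
    intro h
    rw [unitInterval.symm_eq_zero] at h
    exact hp.ne h
  rw [outLaw, Measure.bind_apply (MeasurableSet.of_discrete) Measurable.of_discrete.aemeasurable,
    lintegral_countable', tsum_eq_single l.length]
  · rw [map_ofFn_uniformOn_singleton hn, if_pos rfl, geometricMeasure_singleton hσ,
      unitInterval.coe_symm_eq, sub_sub_cancel, ENNReal.ofReal_mul (pow_nonneg p.2.1 _),
      ENNReal.ofReal_pow p.2.1, mul_pow]
    ring
  · intro k hk
    rw [map_ofFn_uniformOn_singleton hn, if_neg hk, zero_mul]

/-- The probability of a digraph depends only on the number of its arcs. -/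
theorem digraphLaw_singleton (hn : 1 ≤ n) {p : unitInterval} (hp : p < 1) (g : Arcs n) :
    digraphLaw n p {g} = ENNReal.ofReal (1 - p) ^ n *
      (ENNReal.ofReal p * (n : ENNReal)⁻¹) ^ ∑ v, (g v).length := by
  have := isProbabilityMeasure_outLaw hn p
  rw [digraphLaw, Measure.pi_singleton]
  simp only [outLaw_singleton hn hp, Finset.prod_mul_distrib, Finset.prod_pow_eq_pow_sum,
    Finset.prod_const, Finset.card_univ, Fintype.card_fin]

/-- If a statistic `f` determines the number of arcs, then its distribution in the random digraph is
the number of the digraphs with a given value, up to a factor that depends only on this value. -/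
theorem map_digraphLaw_singleton (hn : 1 ≤ n) {p : unitInterval} (hp : p < 1) {α : Type*}
    [MeasurableSpace α] [MeasurableSingletonClass α] {f : Arcs n → α} {N : α → ℕ}
    (hf : ∀ g, N (f g) = ∑ v, (g v).length) (q : α) :
    (digraphLaw n p).map f {q} = ({g : Arcs n | f g = q}.ncard : ENNReal) *
      (ENNReal.ofReal (1 - p) ^ n * (ENNReal.ofReal p * (n : ENNReal)⁻¹) ^ N q) := by
  have hfin : {g : Arcs n | f g = q}.Finite :=
    (finite_setOf_sum_length_eq n (N q)).subset fun g (hg : f g = q) => by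
      change _ = _
      rw [← hf, hg]
  rw [Measure.map_apply Measurable.of_discrete (measurableSet_singleton q)]
  change digraphLaw n p {g : Arcs n | f g = q} = _
  conv_lhs => rw [← hfin.coe_toFinset, ← sum_measure_singleton]
  rw [Finset.sum_congr rfl fun g hg => by
    rw [digraphLaw_singleton hn hp, ← hf, show f g = q by simpa using hg], Finset.sum_const,
    nsmul_eq_mul, Set.ncard_eq_toFinset_card _ hfin]

theorem identDistrib_digraphLaw_iff (hn : 1 ≤ n) {p : unitInterval} (hp₀ : 0 < p) (hp : p < 1)
    {α : Type*} [Countable α] [MeasurableSpace α] [MeasurableSingletonClass α]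
    {f f' : Arcs n → α} {N : α → ℕ} (hf : ∀ g, N (f g) = ∑ v, (g v).length)
    (hf' : ∀ g, N (f' g) = ∑ v, (g v).length) :
    IdentDistrib f f' (digraphLaw n p) (digraphLaw n p) ↔
      ∀ q, {g : Arcs n | f g = q}.ncard = {g : Arcs n | f' g = q}.ncard := by
  have h1 : ENNReal.ofReal (1 - p) ≠ 0 := by
    simpa using (show (p : ℝ) < 1 from hp)
  have h2 : ENNReal.ofReal p * (n : ENNReal)⁻¹ ≠ 0 := by
    refine mul_ne_zero ?_ (by simp)
    simpa using (show (0 : ℝ) < p from hp₀)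
  have h3 : ENNReal.ofReal p * (n : ENNReal)⁻¹ ≠ ⊤ :=
    ENNReal.mul_ne_top ENNReal.ofReal_ne_top (by simp; omega)
  have h4 : IdentDistrib f f' (digraphLaw n p) (digraphLaw n p) ↔
      (digraphLaw n p).map f = (digraphLaw n p).map f' :=
    ⟨fun h => h.map_eq, fun h => ⟨Measurable.of_discrete.aemeasurable,
      Measurable.of_discrete.aemeasurable, h⟩⟩
  rw [h4, Measure.ext_iff_singleton]
  refine forall_congr' fun q => ?_
  rw [map_digraphLaw_singleton hn hp hf, map_digraphLaw_singleton hn hp hf',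
    ENNReal.mul_left_inj (mul_ne_zero (pow_ne_zero _ h1) (pow_ne_zero _ h2))
      (ENNReal.mul_ne_top (ENNReal.pow_ne_top ENNReal.ofReal_ne_top) (ENNReal.pow_ne_top h3)),
    Nat.cast_inj]

theorem identDistrib_iff_forestGF_eq (hn : 1 ≤ n) {p : unitInterval} (hp₀ : 0 < p) (hp : p < 1) :
    IdentDistrib (fun g : Arcs n => (numL g, numF g, numB g + numC g, numT g))
        (fun g : Arcs n => (numL g, numB g, numF g + numC g, numT g))
        (digraphLaw n p) (digraphLaw n p) ↔
      forestGF (X 1) (X 2) (X 2) (X 3) n (X 0 : MvPowerSeries (Fin 4) ℚ) =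
        forestGF (X 2) (X 1) (X 2) (X 3) n (X 0) := by
  rw [forestGF_eq_iff_ncard_eq]
  refine identDistrib_digraphLaw_iff hn hp₀ hp (N := fun q => q.1 + q.2.1 + q.2.2.1 + q.2.2.2)
    (fun g => ?_) (fun g => ?_) <;>
  · rw [← total_search]
    simp only [State.total, numL, numF, numB, numC, numT]
    omega

end DepthFirst

/-- The first part concerns `(L, F, B + C, T) =_d (L, B, F + C, T)` for all `n ≥ 1` and `0 < p < 1`,
the second part `F_n(w, x, z, z, t) = F_n(w, z, x, z, t)` for all `n ≥ 1`, where the variables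
`w, x, z, t` are `X 0, X 1, X 2, X 3`. -/
theorem mainTheorem2 :
    ((∀ n : ℕ, 1 ≤ n → ∀ p : unitInterval, 0 < p → p < 1 →
        IdentDistrib (fun g : Arcs n => (numL g, numF g, numB g + numC g, numT g))
          (fun g : Arcs n => (numL g, numB g, numF g + numC g, numT g))
          (digraphLaw n p) (digraphLaw n p)) ↔
      ∀ n : ℕ, 1 ≤ n → GX n = GY n) ∧
    ((∀ n : ℕ, 1 ≤ n →
        (genF n).subst (![X 0, X 1, X 2, X 2, X 3] : Fin 5 → MvPowerSeries (Fin 4) ℚ) =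
          (genF n).subst (![X 0, X 2, X 1, X 2, X 3] : Fin 5 → MvPowerSeries (Fin 4) ℚ)) ↔
      ∀ n : ℕ, 1 ≤ n → GX n = GY n) := by
  refine ⟨?_, ?_⟩
  · rw [← forall_forestGF_eq_iff]
    -- Equality in distribution for one value of `p` suffices.
    have hhalf : (0 : unitInterval) < ⟨1 / 2, by norm_num, by norm_num⟩ ∧
        (⟨1 / 2, by norm_num, by norm_num⟩ : unitInterval) < 1 :=
      ⟨Subtype.mk_lt_mk.2 (by norm_num), Subtype.mk_lt_mk.2 (by norm_num)⟩
    exact ⟨fun h n hn => (identDistrib_iff_forestGF_eq hn hhalf.1 hhalf.2).1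
        (h n hn _ hhalf.1 hhalf.2),
      fun h n hn p hp₀ hp => (identDistrib_iff_forestGF_eq hn hp₀ hp).2 (h n hn)⟩
  · rw [← forall_forestGF_eq_iff]
    exact forall₂_congr fun n _ => subst_genF_eq_iff n
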